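/- Let $p$ be a prime. **Proof system.** Formulas are built from variables with $\neg$, $\bigvee$ of unbounded arity and $MOD_{p,i}$ of unbounded arity ($i\in\mathbb Z/p$; the intended meaning of $MOD_{p,i}(y_1,\dots,y_k)$ is $\sum_j y_j\equiv i \pmod p$); arity $0$ is allowed. $\bigwedge_i\varphi_i$ abbreviates $\neg\bigvee_i\neg\varphi_i$, and $\varphi\equiv\psi$ abbreviates $(\neg\varphi\vee\psi)\wedge(\neg\psi\vee\varphi)$. The depth of a formula is the maximal number of alternations of connectives on a branch: adjacent negations count once, adjacent disjunctions count once, every $MOD$ connective counts, and a variable has depth $0$. $LK(MOD_p)$ is the sequent calculus with initial sequents $\varphi\to\varphi$, the structural rules (weakening, contraction, exchange), cut, the left and right $\neg$-rules, the rule $\bigvee$:left (from $\varphi_i,\Gamma\to\Delta$ for all $i\le t$ infer $\bigvee_{i\le t}\varphi_i,\Gamma\to\Delta$), the rule $\bigvee$:right (from $\Gamma\to\Delta,\varphi_j$ with $j\le t$ infer $\Gamma\to\Delta,\bigvee_{i\le t}\varphi_i$), and the axioms $MOD_{p,0}(\emptyset)$; $\neg MOD_{p,i}(\emptyset)$ for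 $i\ne 0$; and $MOD_{p,i}(\Gamma,\varphi)\equiv[(MOD_{p,i}(\Gamma)\wedge\neg\varphi)\vee(MOD_{p,i-1}(\Gamma)\wedge\varphi)]$. $LK_d(MOD_p)$ is the subsystem that uses only formulas of depth at most $d$. A refutation of a set of formulas is a (dag-like) proof of the empty sequent in which also $\to\varphi$, for $\varphi$ in the set, may be used as initial sequents. Its size is the total number of symbols. For a polynomial $f=\sum_{a}c_a x_a$ over $\mathbb F_p$ ($x_a$ distinct monomials, $c_a\in\{1,\dots,p-1\}$), the equation $f=0$ is identified with the formula $MOD_{p,0}(\psi_1,\dots,\psi_k)$, $k=\sum_a c_a$, where the $\psi_j$ are the conjunctions of the variables of the monomials $x_a$, each one repeated $c_a$ times. **Systems.** Let $r:\mathbb N\to\mathbb N$ satisfy $r(n)\ge(\log n)^{\omega(1)}$. For $n\ge1$ let $\mathcal F_n$ be a set of polynomials over $\mathbb F_p$ in the finite set of variables $Var(\mathcal F_n)$ such that (1) the degrees of all $f\in\mathcal F_n$ are bounded by a constant independent of $n$; (2) $|\mathcal F_n|$ and $|Var(\mathcal F_n)|$ are $n^{O(1)}$; (3) $x^2-x\in\mathcal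 F_n$ for all $x\in Var(\mathcal F_n)$, and the system $f=0$, $f\in\mathcal F_n$, has no solution in $\mathbb F_p$. **Search trees.** Let $S_{\mathcal F_n,e}$ be the $\mathbb F_p$-vector space of multilinear polynomials of degree at most $e$ in the variables $Var(\mathcal F_n)$, where polynomials are identified with their multilinear representatives modulo all $x^2-x$. An $S_{\mathcal F_n,e}$-search tree is a $p$-ary tree whose inner nodes are labelled by elements $g\in S_{\mathcal F_n,e}$, the $p$ edges leaving such a node being labelled $g=0,\dots,g=p-1$. A map $B:S_{\mathcal F_n,e}\to\mathbb F_p$ determines the path that follows the edges $g=B(g)$, and $T(B)$ denotes the label of the leaf reached. Let $ER_{\mathcal F_n,e}$ be the set of the following labels, each given with the condition under which it is an error for $B$ (where all polynomials at which $B$ is evaluated must lie in $S_{\mathcal F_n,e}$): $(B1,c)$, $c\in\mathbb F_p$: $B(c)\ne c$; $(B1,x)$, $x$ a variable: $B(x)\notin\{0,1\}$; $(B2,f,g)$: $B(f)+B(g)\ne B(f+g)$; $(B3,x_a,x_b)$, $x_a,x_b$ monomials: $B(x_a)B(x_b)\ne B(x_a\cdot x_b)$; $(B4,f)$, $f\in\mathcal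 F_n$: $B(f)\ne0$. **Theorem 6.2.** For every $d\ge2$ there are $\epsilon_d>0$, $n_d\ge1$ and $\delta>0$ such that for all $n\ge n_d$, all non-empty sets $\Omega$ of maps from $S_{\mathcal F_n,r(n)}$ to $\mathbb F_p$, and all $0<\epsilon\le\epsilon_d$ the following implication holds. If for every $S_{\mathcal F_n,r(n)}$-search tree $T$ of depth at most $r(n)$ with leaves labelled by elements of $ER_{\mathcal F_n,r(n)}$, $$\mathrm{Prob}_{B\in\Omega}[\,T(B)\text{ is not an error for }B\,]>1-2^{-r(n)^{\epsilon}}$$ ($B$ uniformly distributed in $\Omega$), then every $LK_d(MOD_p)$ refutation of the set of formulas $f=0$, $f\in\mathcal F_n$, has size at least $2^{\delta\, r(n)^{\epsilon}}$. -/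

import Mathlib

open Filter

namespace ModFrege

universe u

/-! ### Formulas -/

/-- Formulas over the variables `V` with the connectives `¬`, unbounded-arity `⋁`, and
unbounded-arity `MOD_{p,i}` for `i` modulo `p` (the intended meaning of `MOD_{p,i}(y₁,…,y_k)`
is `∑ y_j ≡ i (mod p)`).  The arities may be `0`. -/
inductive Formula (p : ℕ) (V : Type u) : Type u
  | var : V → Formula p V
  | neg : Formula p V → Formula p V
  | or : List (Formula p V) → Formula p V
  | mod : ZMod p → List (Formula p V) → Formula p V

namespace Formula

variable {p : ℕ} {V : Type u}

/-- The outermost connective of the formula is `¬`. -/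
def IsNeg : Formula p V → Bool
  | neg _ => true
  | _ => false

/-- The outermost connective of the formula is `⋁`. -/
def IsOr : Formula p V → Bool
  | or _ => true
  | _ => false

mutual
/-- The depth: the maximal number of blocks of equal connectives on a branch of the formula.
Adjacent negations form one block and adjacent disjunctions form one block, while every
`MOD` connective counts.  So variables have depth `0`, `⋁ⱼ pⱼ` has depth `1` and
`¬p ∨ ¬q` has depth `2`. -/
def depth : Formula p V → ℕ
  | var _ => 0
  | neg φ => if φ.IsNeg then depth φ else depth φ + 1
  | or φs => max 1 (depthUnderOr φs)
  | mod _ φs => depthMax φs + 1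
/-- The maximum over the disjuncts of their contribution to the depth of the disjunction. -/
def depthUnderOr : List (Formula p V) → ℕ
  | [] => 0
  | φ :: φs => max (if φ.IsOr then depth φ else depth φ + 1) (depthUnderOr φs)
/-- The maximal depth of a formula in the list. -/
def depthMax : List (Formula p V) → ℕ
  | [] => 0
  | φ :: φs => max (depth φ) (depthMax φs)
end

mutual
/-- The number of symbols (variables and connectives) of a formula. -/
def size : Formula p V → ℕ
  | var _ => 1
  | neg φ => size φ + 1
  | or φs => sizeSum φs + 1
  | mod _ φs => sizeSum φs + 1
/-- The total number of symbols of the formulas in a list. -/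
def sizeSum : List (Formula p V) → ℕ
  | [] => 0
  | φ :: φs => size φ + sizeSum φs
end

/-- Conjunction, as an abbreviation `⋀ φᵢ := ¬ ⋁ ¬ φᵢ`. -/
def and (φs : List (Formula p V)) : Formula p V := neg (or (φs.map neg))

/-- Equivalence, as an abbreviation. -/
def iff (φ ψ : Formula p V) : Formula p V := and [or [neg φ, ψ], or [neg ψ, φ]]

end Formula

/-- The `MOD_p`-axioms. -/
inductive IsModAxiom {p : ℕ} {V : Type u} : Formula p V → Prop
  | empty_zero : IsModAxiom (.mod 0 [])
  | empty_ne (i : ZMod p) (hi : i ≠ 0) : IsModAxiom (.neg (.mod i []))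
  | step (i : ZMod p) (Γ : List (Formula p V)) (φ : Formula p V) :
      IsModAxiom (.iff (.mod i (Γ ++ [φ]))
        (.or [.and [.mod i Γ, .neg φ], .and [.mod (i - 1) Γ, φ]]))

/-! ### The sequent calculus `LK(MOD_p)` -/

/-- A sequent `Γ → Δ`. -/
structure Sequent (p : ℕ) (V : Type u) where
  /-- the antecedent `Γ` -/
  ante : List (Formula p V)
  /-- the succedent `Δ` -/
  succ : List (Formula p V)

/-- `Infer A P S`: the sequent `S` is an initial sequent, or it follows by one rule from
sequents satisfying `P`.  The members of `A` are non-logical axioms. -/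
inductive Infer {p : ℕ} {V : Type u} (A : Set (Formula p V)) (P : Sequent p V → Prop) :
    Sequent p V → Prop
  | init (φ : Formula p V) : Infer A P ⟨[φ], [φ]⟩
  | modAxiom (φ : Formula p V) : IsModAxiom φ → Infer A P ⟨[], [φ]⟩
  | nonlogical (φ : Formula p V) : φ ∈ A → Infer A P ⟨[], [φ]⟩
  | weakLeft (φ : Formula p V) (Γ Δ : List (Formula p V)) :
      P ⟨Γ, Δ⟩ → Infer A P ⟨φ :: Γ, Δ⟩
  | weakRight (φ : Formula p V) (Γ Δ : List (Formula p V)) :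
      P ⟨Γ, Δ⟩ → Infer A P ⟨Γ, φ :: Δ⟩
  | contrLeft (φ : Formula p V) (Γ Δ : List (Formula p V)) :
      P ⟨φ :: φ :: Γ, Δ⟩ → Infer A P ⟨φ :: Γ, Δ⟩
  | contrRight (φ : Formula p V) (Γ Δ : List (Formula p V)) :
      P ⟨Γ, φ :: φ :: Δ⟩ → Infer A P ⟨Γ, φ :: Δ⟩
  | exchange (Γ Γ' Δ Δ' : List (Formula p V)) : Γ.Perm Γ' → Δ.Perm Δ' →
      P ⟨Γ, Δ⟩ → Infer A P ⟨Γ', Δ'⟩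
  | cut (φ : Formula p V) (Γ Δ : List (Formula p V)) :
      P ⟨Γ, φ :: Δ⟩ → P ⟨φ :: Γ, Δ⟩ → Infer A P ⟨Γ, Δ⟩
  | negLeft (φ : Formula p V) (Γ Δ : List (Formula p V)) :
      P ⟨Γ, φ :: Δ⟩ → Infer A P ⟨.neg φ :: Γ, Δ⟩
  | negRight (φ : Formula p V) (Γ Δ : List (Formula p V)) :
      P ⟨φ :: Γ, Δ⟩ → Infer A P ⟨Γ, .neg φ :: Δ⟩
  | orLeft (φs Γ Δ : List (Formula p V)) :
      (∀ φ ∈ φs, P ⟨φ :: Γ, Δ⟩) → Infer A P ⟨.or φs :: Γ, Δ⟩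
  | orRight (φs : List (Formula p V)) (φ : Formula p V) (Γ Δ : List (Formula p V)) :
      φ ∈ φs → P ⟨Γ, φ :: Δ⟩ → Infer A P ⟨Γ, .or φs :: Δ⟩

/-- `π` is an `LK_d(MOD_p)` refutation of the set of formulas `A`: a sequence of sequents, each
initial or inferred from earlier ones, ending with the empty sequent, in which every formula has
depth at most `d`. -/
structure IsRefutation {p : ℕ} {V : Type u} (d : ℕ) (A : Set (Formula p V))
    (π : List (Sequent p V)) : Prop where
  infer : ∀ k (hk : k < π.length), Infer A (fun S => S ∈ π.take k) π[k]
  last : π.getLast? = some ⟨[], []⟩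
  depth_le : ∀ S ∈ π, ∀ φ ∈ S.ante ++ S.succ, φ.depth ≤ d

/-- The number of symbols of a sequence of sequents, where each sequent contributes its arrow
and the symbols of its formulas. -/
def proofSize {p : ℕ} {V : Type u} (π : List (Sequent p V)) : ℕ :=
  (π.map fun S => 1 + Formula.sizeSum S.ante + Formula.sizeSum S.succ).sum

/-! ### Polynomial equations as formulas -/

/-- The formula expressing `f = 0` on Boolean variables: `MOD_{p,0}` of the list that contains,
for every monomial of `f`, the conjunction of its variables, repeated `c` times where
`c ∈ {1, …, p - 1}` is the coefficient. -/
noncomputable def eqFormula {p : ℕ} {V : Type u} (f : MvPolynomial V (ZMod p)) : Formula p V :=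
  .mod 0 (f.support.toList.flatMap fun m =>
    List.replicate (f.coeff m).val (.and (m.support.toList.map .var)))

/-! ### Low-degree multilinear polynomials -/

/-- The `𝔽_p`-vector space of multilinear polynomials of degree at most `e`. -/
noncomputable def LowDeg (p : ℕ) (V : Type u) (e : ℕ) :
    Submodule (ZMod p) (MvPolynomial V (ZMod p)) :=
  MvPolynomial.restrictDegree V (ZMod p) 1 ⊓ MvPolynomial.restrictTotalDegree V (ZMod p) e

/-- The multilinear monomial `x_a`. -/
noncomputable def mono (p : ℕ) {V : Type u} (a : Finset V) : MvPolynomial V (ZMod p) :=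
  ∏ i ∈ a, MvPolynomial.X i

/-- The multilinear polynomial that is congruent to `f` modulo the ideal generated by the
polynomials `x ^ 2 - x`: every power `x ^ k` with `k ≥ 1` is replaced by `x`. -/
noncomputable def multilin {p : ℕ} {V : Type u} (f : MvPolynomial V (ZMod p)) :
    MvPolynomial V (ZMod p) :=
  ∑ m ∈ f.support, f.coeff m • mono p m.support

/-! ### Errors and search trees -/

/-- Names of possible rule violations by a map on `LowDeg p V e`. -/
inductive ErrorLabel (p : ℕ) {V : Type u} (F : Finset (MvPolynomial V (ZMod p))) (e : ℕ) : Type u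
  | const (c : ZMod p)
  | var (x : V)
  | add (f g : LowDeg p V e)
  | mul (a b : Finset V)
  | eqn (f : MvPolynomial V (ZMod p)) (hf : f ∈ F)

open scoped Classical in
/-- The label is an error for `B`, that is, `B` violates the named instance of the named rule:
constants get their value; variables get `0` or `1`; sums are respected; products `x_a x_b` of
monomials are respected (the product, reduced modulo `x ^ 2 - x`, is `x_{a ∪ b}`); the
polynomials of the system get value `0`.  All polynomials involved have to lie in the domain
of `B`. -/
def ErrorLabel.IsError {p : ℕ} {V : Type u} {F : Finset (MvPolynomial V (ZMod p))} {e : ℕ}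
    (B : LowDeg p V e → ZMod p) : ErrorLabel p F e → Prop
  | const c => ∃ u : LowDeg p V e, (u : MvPolynomial V (ZMod p)) = MvPolynomial.C c ∧ B u ≠ c
  | var x => ∃ u : LowDeg p V e, (u : MvPolynomial V (ZMod p)) = MvPolynomial.X x ∧
      B u ≠ 0 ∧ B u ≠ 1
  | add f g => B f + B g ≠ B (f + g)
  | mul a b => ∃ u v w : LowDeg p V e, (u : MvPolynomial V (ZMod p)) = mono p a ∧
      (v : MvPolynomial V (ZMod p)) = mono p b ∧
      (w : MvPolynomial V (ZMod p)) = mono p (a ∪ b) ∧ B u * B v ≠ B w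
  | eqn f _ => ∃ u : LowDeg p V e, (u : MvPolynomial V (ZMod p)) = multilin f ∧ B u ≠ 0

/-- `p`-ary search trees: inner nodes are labelled by elements of `Q`, the edges leaving an inner
node by the elements of `ZMod p`, the leaves by elements of `X`. -/
inductive SearchTree (p : ℕ) (Q X : Type u) : Type u
  | leaf : X → SearchTree p Q X
  | node : Q → (ZMod p → SearchTree p Q X) → SearchTree p Q X

/-- All branches of the tree have at most `k` edges. -/
def SearchTree.DepthLE {p : ℕ} {Q X : Type u} : SearchTree p Q X → ℕ → Prop
  | leaf _, _ => True
  | node _ _, 0 => False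
  | node _ t, k + 1 => ∀ c, (t c).DepthLE k

/-- The label of the leaf at the end of the path determined by `B`. -/
def SearchTree.eval {p : ℕ} {Q X : Type u} (B : Q → ZMod p) : SearchTree p Q X → X
  | leaf x => x
  | node g t => (t (B g)).eval B

open scoped Classical in
/-- The probability, for `B` uniformly distributed in `Ω`, that the output of `T` on `B` is not an
error for `B`. -/
noncomputable def probNoError {p : ℕ} {V : Type u} {F : Finset (MvPolynomial V (ZMod p))} {e : ℕ}
    (Ω : Finset (LowDeg p V e → ZMod p)) (T : SearchTree p (LowDeg p V e) (ErrorLabel p F e)) :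
    ℝ :=
  ((Ω.filter fun B => ¬ (T.eval B).IsError B).card : ℝ) / (Ω.card : ℝ)

end ModFrege

/-!
Following Razborov and Smolensky, each disjunction is replaced by `1 - ∏ i < h, (1 - Lᵢ ^ (p - 1))`,
where the `Lᵢ` are random linear combinations of its disjuncts, so that every formula of depth `d`
becomes a polynomial of degree `h ^ O(d)`. A map `B` thereby assigns a truth value to every formula
of a refutation. Unless `B` hides a true disjunct from all the combinations of some disjunction,
which for suitable coefficients happens for at most half of the maps in `Ω`, every violation of
Tarski's conditions can be traced to an error of `B` by few queries. Since the refutation proves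
the empty sequent from true initial sequents, binary search along it, with the formulas saying that
one of the first `i` sequents is false as tests, locates such a violation. The resulting tree is
shallow, so it contradicts the assumption unless the refutation is long.
-/

namespace ModFrege

universe u

theorem SearchTree.DepthLE.mono {p : ℕ} {Q X : Type u} {T : SearchTree p Q X} {k l : ℕ}
    (h : T.DepthLE k) (hkl : k ≤ l) : T.DepthLE l := by
  induction T generalizing k l with
  | leaf x => trivial
  | node q t ih =>
    match k, l, h, hkl with
    | k + 1, l + 1, h, hkl => exact fun c => ih c (h c) (Nat.succ_le_succ_iff.1 hkl)

/-! ### Statements forced by few queries -/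

section Forced

variable {p : ℕ} {Q X : Type u}

/-- Whether `Ψ B` holds depends only on the values of `B` at some `t` fixed queries. -/
def DecidedBy (t : ℕ) (Ψ : (Q → ZMod p) → Prop) : Prop :=
  ∃ gs : List Q, gs.length ≤ t ∧ ∀ B B', (∀ g ∈ gs, B g = B' g) → Ψ B → Ψ B'

/-- An oracle `B` can violate `Φ` only at the price of a detectable error: some search tree of
depth at most `k` finds a label that is an error, in the sense of `E`, for every `B` that does
not satisfy `Φ`. -/
def Forced (E : (Q → ZMod p) → X → Prop) (k : ℕ) (Φ : (Q → ZMod p) → Prop) : Prop :=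
  ∃ T : SearchTree p Q X, T.DepthLE k ∧ ∀ B, ¬ Φ B → E B (T.eval B)

/-- Whether a given label is an error is decided by `v` queries. -/
class VerifiableBy (E : (Q → ZMod p) → X → Prop) (v : outParam ℕ) : Prop where
  decidedBy (E) (x : X) : DecidedBy v fun B => E B x

variable {E : (Q → ZMod p) → X → Prop} {k l t v : ℕ} {Φ Φ' Ψ : (Q → ZMod p) → Prop}

theorem DecidedBy.of_query (g : Q) (R : ZMod p → Prop) : DecidedBy 1 fun B => R (B g) :=
  ⟨[g], le_rfl, fun _ _ hB => (congrArg R (hB g List.mem_cons_self)).mp⟩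

theorem DecidedBy.exists_subsingleton {α : Type*} {D : Set α} (hD : D.Subsingleton)
    {Ψ : α → (Q → ZMod p) → Prop} (h : ∀ a, DecidedBy t (Ψ a)) :
    DecidedBy t fun B => ∃ a, a ∈ D ∧ Ψ a B := by
  by_cases hne : ∃ a, a ∈ D
  · obtain ⟨a, ha⟩ := hne
    obtain ⟨gs, hlen, hgs⟩ := h a
    refine ⟨gs, hlen, fun B B' hB ⟨b, hb, hΨ⟩ => ⟨a, ha, hgs B B' hB ?_⟩⟩
    rwa [hD ha hb]
  · exact ⟨[], by simp, fun _ _ _ ⟨a, ha, _⟩ => (hne ⟨a, ha⟩).elim⟩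

namespace Forced

theorem mono (h : Forced E k Φ) (hk : k ≤ l) (hΦ : ∀ B, Φ B → Φ' B) : Forced E l Φ' := by
  obtain ⟨T, hT, hE⟩ := h
  exact ⟨T, hT.mono hk, fun B hB => hE B (mt (hΦ B) hB)⟩

theorem imp (h : Forced E k Φ) (hΦ : ∀ B, Φ B → Φ' B) : Forced E k Φ' := h.mono le_rfl hΦ

theorem le (h : Forced E k Φ) (hk : k ≤ l) : Forced E l Φ := h.mono hk fun _ => id

theorem of_label (x : X) (h : ∀ B, ¬ Φ B → E B x) : Forced E k Φ := ⟨.leaf x, trivial, h⟩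

theorem of_forall [hX : Nonempty X] (h : ∀ B, Φ B) : Forced E k Φ :=
  hX.elim fun x => of_label x fun B hB => (hB (h B)).elim

theorem query (g : Q) (h : ∀ c, Forced E k fun B => B g = c → Φ B) : Forced E (k + 1) Φ := by
  choose T hT hE using h
  exact ⟨.node g T, hT, fun B hB => hE (B g) B fun hΦ => hB (hΦ rfl)⟩

theorem query_list (gs : List Q)
    (h : ∀ B₀ : Q → ZMod p, Forced E k fun B => (∀ g ∈ gs, B g = B₀ g) → Φ B) :
    Forced E (k + gs.length) Φ := by
  classical
  induction gs generalizing Φ with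
  | nil => exact (h fun _ => 0).imp fun B hB => hB (by simp)
  | cons g gs ih =>
    rw [List.length_cons, ← add_assoc]
    refine query g fun c => ih fun B₀ => (h (Function.update B₀ g c)).imp fun B hB hB₀ hc => ?_
    refine hB fun g' hg' => ?_
    by_cases hgg : g' = g
    · rw [hgg, hc, Function.update_self]
    · rw [Function.update_of_ne hgg, hB₀ g' (List.mem_of_ne_of_mem hgg hg')]

theorem by_cases (hΨ : DecidedBy t Ψ) (h : Forced E k fun B => Ψ B → Φ B)
    (h' : Forced E k fun B => ¬ Ψ B → Φ B) : Forced E (k + t) Φ := by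
  obtain ⟨gs, hlen, hgs⟩ := hΨ
  refine (query_list gs fun B₀ => ?_).le (Nat.add_le_add_left hlen k)
  by_cases h₀ : Ψ B₀
  · exact h.imp fun B hΦ hB => hΦ (hgs B₀ B (fun g hg => (hB g hg).symm) h₀)
  · exact h'.imp fun B hΦ hB => hΦ fun hΨ => h₀ (hgs B B₀ hB hΨ)

theorem bind (T : SearchTree p Q X) (hT : T.DepthLE k)
    (h : ∀ x, Forced E l fun B => T.eval B = x → Φ B) : Forced E (l + k) Φ := by
  induction T generalizing k Φ with
  | leaf x => exact (h x).mono (Nat.le_add_right l k) fun B hB => hB rfl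
  | node q t ih =>
    cases k with
    | zero => exact hT.elim
    | succ k =>
      refine query q fun c => ih c (hT c) fun x => (h x).imp fun B hΦ hx hc => hΦ ?_
      rwa [SearchTree.eval, hc]

/-- The label found for `Φ` is verified; if it is no error then `Φ` holds, and the search for an
error goes on with `Φ'`. -/
theorem and [VerifiableBy E v] (h : Forced E k Φ) (h' : Forced E l Φ') :
    Forced E (k + l + v) fun B => Φ B ∧ Φ' B := by
  obtain ⟨T, hT, hE⟩ := h
  refine (bind (l := l + v) T hT fun x => by_cases (VerifiableBy.decidedBy E x)
    (of_label x fun B hB => ?_) (h'.imp fun B hΦ' hx hTB => ⟨?_, hΦ'⟩)).le (by omega)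
  · by_contra hx
    exact hB fun hx' => (hx hx').elim
  · by_contra hΦ
    exact hx (hTB ▸ hE B hΦ)

theorem not_of_imp_not [VerifiableBy E v] {P : (Q → ZMod p) → Prop}
    (h : Forced E k fun B => P B → Φ B) (h' : Forced E l fun B => P B → ¬ Φ B) :
    Forced E (k + l + v) fun B => ¬ P B :=
  (h.and h').imp fun _ hB hP => hB.2 hP (hB.1 hP)

theorem forall_mem [Nonempty X] [VerifiableBy E v] {ι : Type*} (s : Finset ι)
    {Φ : ι → (Q → ZMod p) → Prop} (h : ∀ i ∈ s, Forced E k (Φ i)) :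
    Forced E (s.card * (k + v)) fun B => ∀ i ∈ s, Φ i B := by
  classical
  induction s using Finset.induction_on with
  | empty => exact of_forall (by simp)
  | insert i s hi ih =>
    simp only [Finset.forall_mem_insert] at h ⊢
    exact (h.1.and (ih h.2)).le (by rw [Finset.card_insert_of_notMem hi]; linarith)

theorem forall_mem_list [Nonempty X] [VerifiableBy E v] {ι : Type*} (l : List ι)
    {Φ : ι → (Q → ZMod p) → Prop} (h : ∀ i ∈ l, Forced E k (Φ i)) :
    Forced E (l.length * (k + v)) fun B => ∀ i ∈ l, Φ i B := by
  classical
  exact (forall_mem l.toFinset fun i hi => h i (List.mem_toFinset.1 hi)).mono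
    (Nat.mul_le_mul_right _ l.toFinset_card_le) fun B hB i hi => hB i (List.mem_toFinset.2 hi)

theorem forall_of_decided [Nonempty X] {ι : Type*} {P : (Q → ZMod p) → Prop}
    {Ψ : ι → (Q → ZMod p) → Prop} (s : Finset ι) (hΨ : ∀ i ∈ s, DecidedBy t (Ψ i))
    (h : ∀ i ∈ s, Forced E k fun B => P B → Ψ i B) :
    Forced E (k + s.card * t) fun B => P B → ∀ i ∈ s, Ψ i B := by
  classical
  induction s using Finset.induction_on with
  | empty => exact of_forall (by simp)
  | insert i s hi ih =>
    simp only [Finset.forall_mem_insert] at hΨ h ⊢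
    rw [Finset.card_insert_of_notMem hi, Nat.succ_mul, ← add_assoc]
    refine by_cases hΨ.1 ((ih hΨ.2 h.2).imp fun B hB hi hP => ⟨hi, hB hP⟩)
      (h.1.mono (Nat.le_add_right _ _) fun B hB hi hP => (hi (hB hP)).elim)

/-- If a chain of decided statements breaks, binary search finds a link at which it breaks. -/
theorem binary_search [Nonempty X] {P : (Q → ZMod p) → Prop} {Ψ : ℕ → (Q → ZMod p) → Prop}
    (hΨ : ∀ i, DecidedBy t (Ψ i)) {m a b : ℕ} (hab : a ≤ b) (hm : b ≤ a + 2 ^ m)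
    (h : ∀ i, a ≤ i → i < b → Forced E k fun B => P B → Ψ i B → Ψ (i + 1) B) :
    Forced E (k + m * t) fun B => P B → Ψ a B → Ψ b B := by
  induction m generalizing a b with
  | zero =>
    rcases hab.eq_or_lt with rfl | hlt
    · exact of_forall fun _ _ => id
    · obtain rfl : b = a + 1 := by omega
      simpa using h a le_rfl hlt
  | succ m ih =>
    rw [pow_succ] at hm
    obtain ⟨c, hac, hcb, hca, hbc⟩ : ∃ c, a ≤ c ∧ c ≤ b ∧ c ≤ a + 2 ^ m ∧ b ≤ c + 2 ^ m :=
      ⟨a + (b - a) / 2, by omega, by omega, by omega, by omega⟩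
    rw [Nat.succ_mul, ← add_assoc]
    refine by_cases (hΨ c)
      ((ih hcb hbc fun i hi hib => h i (hac.trans hi) hib).imp ?_)
      ((ih hac hca fun i hi hic => h i hi (hic.trans_le hcb)).imp ?_)
    · exact fun B hB hc hP _ => hB hP hc
    · exact fun B hB hc hP ha => (hc (hB hP ha)).elim

theorem finset_induction [Nonempty X] {ι : Type*} [DecidableEq ι] {P : (Q → ZMod p) → Prop}
    {Ψ : Finset ι → (Q → ZMod p) → Prop} (hΨ : ∀ s, DecidedBy t (Ψ s)) {m : ℕ} {s : Finset ι}
    (hs : s.card ≤ 2 ^ m)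
    (h : ∀ x s', x ∉ s' → insert x s' ⊆ s →
      Forced E k fun B => P B → Ψ s' B → Ψ (insert x s') B) :
    Forced E (k + m * t) fun B => P B → Ψ ∅ B → Ψ s B := by
  have main := binary_search (E := E) (k := k) (P := P) (m := m)
    (Ψ := fun i => Ψ (s.toList.take i).toFinset) (fun i => hΨ _)
    (a := 0) (b := s.toList.length) (by simp) (by simpa using hs) fun i _ hi => ?_
  · rw [List.take_length, Finset.toList_toFinset] at main
    exact main
  · have htake : (s.toList.take (i + 1)).toFinset =
        insert s.toList[i] (s.toList.take i).toFinset := by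
      rw [← List.take_append_getElem hi, List.toFinset_append, Finset.union_comm]; rfl
    rw [htake]
    refine h _ _ (fun hmem => ?_) (htake ▸ fun x hx => ?_)
    · obtain ⟨j, hj, hji⟩ := List.mem_iff_getElem.1 (List.mem_toFinset.1 hmem)
      rw [List.getElem_take] at hji
      have := s.nodup_toList.getElem_inj_iff.1 hji
      simp at hj; omega
    · exact Finset.mem_toList.1 (List.mem_of_mem_take (List.mem_toFinset.1 hx))

end Forced

end Forced

/-! ### Values of polynomials -/

section Values

open MvPolynomial

variable {p : ℕ} {V : Type u} {F : Finset (MvPolynomial V (ZMod p))} {e : ℕ}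

instance : Nonempty (ErrorLabel p F e) := ⟨.const 0⟩

theorem subsingleton_coe_eq (q : MvPolynomial V (ZMod p)) :
    {w : LowDeg p V e | (w : MvPolynomial V (ZMod p)) = q}.Subsingleton :=
  fun _ hw _ hw' => Subtype.ext (Eq.trans hw (Eq.symm hw'))

theorem decidedBy_exists_coe_eq (q : MvPolynomial V (ZMod p)) (R : ZMod p → Prop) :
    DecidedBy 1 fun B : LowDeg p V e → ZMod p =>
      ∃ w : LowDeg p V e, (w : MvPolynomial V (ZMod p)) = q ∧ R (B w) :=
  DecidedBy.exists_subsingleton (subsingleton_coe_eq q) fun w =>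
    DecidedBy.of_query w R

instance : VerifiableBy (ErrorLabel.IsError (F := F) (e := e)) 3 where
  decidedBy x := by
    have weaken {Ψ : (LowDeg p V e → ZMod p) → Prop} (h : DecidedBy 1 Ψ) : DecidedBy 3 Ψ := by
      obtain ⟨gs, hlen, hgs⟩ := h
      exact ⟨gs, hlen.trans (by norm_num), hgs⟩
    cases x with
    | const c => exact weaken (decidedBy_exists_coe_eq (C c) (· ≠ c))
    | var x => exact weaken (decidedBy_exists_coe_eq (X x) fun z => z ≠ 0 ∧ z ≠ 1)
    | eqn f hf => exact weaken (decidedBy_exists_coe_eq (multilin f) (· ≠ 0))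
    | add f g =>
      refine ⟨[f, g, f + g], le_rfl, fun B B' hB h => ?_⟩
      simp only [List.forall_mem_cons] at hB
      simpa only [ErrorLabel.IsError, hB] using h
    | mul a b =>
      simp only [ErrorLabel.IsError, exists_and_left]
      refine DecidedBy.exists_subsingleton (subsingleton_coe_eq _) fun u =>
        DecidedBy.exists_subsingleton (subsingleton_coe_eq _) fun v =>
          DecidedBy.exists_subsingleton (subsingleton_coe_eq _) fun w =>
            ⟨[u, v, w], le_rfl, fun B B' hB h => ?_⟩
      simp only [List.forall_mem_cons] at hB
      simpa only [hB] using h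

/-- `Forced` for oracles on the multilinear polynomials of degree at most `e`, where the errors
are the violations of the rules for the system `F`. -/
abbrev ForcedOver (F : Finset (MvPolynomial V (ZMod p))) (k : ℕ)
    (Φ : (LowDeg p V e → ZMod p) → Prop) : Prop :=
  Forced (ErrorLabel.IsError (F := F)) k Φ

theorem totalDegree_monomial_le_degree (m : V →₀ ℕ) (c : ZMod p) :
    (monomial m c).totalDegree ≤ m.degree :=
  totalDegree_monomial_le m c

theorem totalDegree_mono_le (a : Finset V) : (mono p a).totalDegree ≤ a.card :=
  (totalDegree_finsetProd _ _).trans <| (Finset.sum_le_card_nsmul _ _ 1 fun i _ =>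
    (totalDegree_monomial_le_degree _ _).trans (by simp)).trans (by simp)

theorem mono_mem_lowDeg {a : Finset V} (ha : a.card ≤ e) : mono p a ∈ LowDeg p V e := by
  classical
  refine Submodule.mem_inf.2 ⟨?_, ?_⟩
  · have hmono : mono p a = monomial (∑ i ∈ a, Finsupp.single i 1) 1 :=
      (monomial_sum_one a fun i => Finsupp.single i 1).symm
    rw [mem_restrictDegree, hmono]
    intro s hs i
    rw [Finset.mem_singleton.1 (support_monomial_subset hs), Finsupp.finsetSum_apply]
    simp only [Finsupp.single_apply, Finset.sum_ite_eq']
    split <;> simp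
  · exact (mem_restrictTotalDegree ..).2 ((totalDegree_mono_le a).trans ha)

variable (p V) in
/-- Multilinear reduction as a linear map. -/
noncomputable def multilinMap : MvPolynomial V (ZMod p) →ₗ[ZMod p] MvPolynomial V (ZMod p) :=
  (basisMonomials V (ZMod p)).constr (ZMod p) fun m => mono p m.support

theorem multilinMap_monomial (m : V →₀ ℕ) (c : ZMod p) :
    multilinMap p V (monomial m c) = c • mono p m.support := by
  have hm : monomial m c = c • basisMonomials V (ZMod p) m := by simp [smul_monomial]
  rw [hm, map_smul, multilinMap, Module.Basis.constr_basis]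

theorem multilin_eq_multilinMap (f : MvPolynomial V (ZMod p)) :
    multilin f = multilinMap p V f := by
  conv_rhs => rw [← support_sum_monomial_coeff f, map_sum]
  exact Finset.sum_congr rfl fun m _ => (multilinMap_monomial _ _).symm

theorem card_support_le_degree (m : V →₀ ℕ) : m.support.card ≤ m.degree := by
  rw [Finset.card_eq_sum_ones]
  exact Finset.sum_le_sum fun i hi => Nat.one_le_iff_ne_zero.2 (Finsupp.mem_support_iff.1 hi)

theorem multilin_mem_lowDeg {f : MvPolynomial V (ZMod p)} (hf : f.totalDegree ≤ e) :
    multilin f ∈ LowDeg p V e := by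
  refine Submodule.sum_mem _ fun m hm => Submodule.smul_mem _ _ (mono_mem_lowDeg ?_)
  exact (card_support_le_degree m).trans ((le_totalDegree hm).trans hf)

open scoped Classical in
/-- The multilinear representative of `f`, and `0` if the degree of `f` exceeds `e`. -/
noncomputable def toLow (e : ℕ) (f : MvPolynomial V (ZMod p)) : LowDeg p V e :=
  if h : f.totalDegree ≤ e then ⟨multilin f, multilin_mem_lowDeg h⟩ else 0

theorem coe_toLow {f : MvPolynomial V (ZMod p)} (h : f.totalDegree ≤ e) :
    (toLow e f : MvPolynomial V (ZMod p)) = multilin f := by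
  simp [toLow, h]

theorem coe_toLow_monomial {m : V →₀ ℕ} (hm : m.degree ≤ e) :
    (toLow e (monomial m (1 : ZMod p)) : MvPolynomial V (ZMod p)) = mono p m.support := by
  rw [coe_toLow ((totalDegree_monomial_le_degree _ _).trans hm), multilin_eq_multilinMap,
    multilinMap_monomial, one_smul]

/-- The value of `B` at the multilinear representative of `f`. -/
noncomputable def val (B : LowDeg p V e → ZMod p) (f : MvPolynomial V (ZMod p)) : ZMod p :=
  B (toLow e f)

theorem decidedBy_val (f : MvPolynomial V (ZMod p)) (R : ZMod p → Prop) :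
    DecidedBy 1 fun B : LowDeg p V e → ZMod p => R (val B f) :=
  DecidedBy.of_query (toLow e f) R

variable {k l : ℕ} {P : (LowDeg p V e → ZMod p) → Prop} {f g : MvPolynomial V (ZMod p)}

theorem forced_add (hf : f.totalDegree ≤ e) (hg : g.totalDegree ≤ e) :
    ForcedOver F (e := e) k fun B => val B (f + g) = val B f + val B g := by
  have hfg : toLow e (f + g) = toLow e f + toLow e g := by
    apply Subtype.ext
    rw [Submodule.coe_add, coe_toLow hf, coe_toLow hg,
      coe_toLow ((totalDegree_add f g).trans (max_le hf hg))]
    simp only [multilin_eq_multilinMap, map_add]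
  refine .of_label (.add (toLow e f) (toLow e g)) fun B hB h => hB ?_
  rw [val, hfg]
  exact h.symm

theorem forced_C (c : ZMod p) : ForcedOver F (e := e) k fun B => val B (C c) = c := by
  refine .of_label (.const c) fun B hB => ⟨toLow e (C c), ?_, hB⟩
  rw [coe_toLow (by simp), multilin_eq_multilinMap, C_apply, multilinMap_monomial]
  simp [mono, smul_eq_C_mul]

theorem forced_zero : ForcedOver F (e := e) k fun B => val B 0 = 0 := by
  simpa using forced_C (F := F) (e := e) (k := k) 0

theorem forced_one : ForcedOver F (e := e) k fun B => val B 1 = 1 := by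
  simpa using forced_C (F := F) (e := e) (k := k) 1

theorem forced_X (he : 1 ≤ e) (x : V) :
    ForcedOver F (e := e) k fun B => val B (X x) = 0 ∨ val B (X x) = 1 := by
  refine .of_label (.var x) fun _ hB => ⟨toLow e (X x), ?_, not_or.1 hB⟩
  rw [X, coe_toLow_monomial (by simpa using he)]
  simp [mono, X]

theorem forced_eqn (hf : f ∈ F) (he : f.totalDegree ≤ e) :
    ForcedOver F (e := e) k fun B => val B f = 0 :=
  .of_label (.eqn f hf) fun _ hB => ⟨toLow e f, coe_toLow he, hB⟩

theorem forced_monomial_add {a b : V →₀ ℕ} (h : a.degree + b.degree ≤ e) :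
    ForcedOver F (e := e) k fun B =>
      val B (monomial (a + b) 1) = val B (monomial a 1) * val B (monomial b 1) := by
  classical
  refine .of_label (.mul a.support b.support) fun B hB =>
    ⟨toLow e (monomial a 1), toLow e (monomial b 1), toLow e (monomial (a + b) 1),
      coe_toLow_monomial (by omega), coe_toLow_monomial (by omega), ?_, fun h => hB h.symm⟩
  rw [coe_toLow_monomial (by simpa using h), Finsupp.support_add_eq_union]

theorem forced_nsmul (hf : f.totalDegree ≤ e) (n : ℕ) :
    ForcedOver F (e := e) (3 * n) fun B => val B (n • f) = n * val B f := by
  induction n with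
  | zero => simpa using forced_zero
  | succ n ih =>
    have hadd : ForcedOver F 0 fun B => val B (n • f + f) = val B (n • f) + val B f :=
      forced_add (e := e) ((totalDegree_smul_le _ _).trans hf) hf
    refine (ih.and hadd).mono (by omega) fun B ⟨hn, hs⟩ => ?_
    rw [succ_nsmul, hs, hn]
    push_cast
    ring

section Prime

variable [Fact p.Prime]

theorem forced_C_mul (hf : f.totalDegree ≤ e) (c : ZMod p) :
    ForcedOver F (e := e) (3 * p) fun B => val B (C c * f) = c * val B f := by
  refine (forced_nsmul hf c.val).mono (by have := ZMod.val_lt c; omega) fun B hB => ?_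
  rw [nsmul_eq_mul, ← map_natCast (C (σ := V) (R := ZMod p))] at hB
  simpa using hB

theorem forced_add_C_mul (hf : f.totalDegree ≤ e) (hg : g.totalDegree ≤ e) (c : ZMod p) :
    ForcedOver F (e := e) (3 * p + 3) fun B => val B (f + C c * g) = val B f + c * val B g := by
  have hcg : (C c * g).totalDegree ≤ e := (totalDegree_mul _ _).trans (by simpa using hg)
  refine ((forced_C_mul hg c).and (forced_add (k := 0) hf hcg)).imp fun B ⟨hmul, hadd⟩ => ?_
  rw [hadd, hmul]

theorem forced_sub (hf : f.totalDegree ≤ e) (hg : g.totalDegree ≤ e) :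
    ForcedOver F (e := e) (3 * p + 3) fun B => val B (f - g) = val B f - val B g := by
  simpa only [C_neg, C_1, neg_one_mul, ← sub_eq_add_neg] using
    forced_add_C_mul (F := F) hf hg (-1)

theorem forced_one_sub (hf : f.totalDegree ≤ e) :
    ForcedOver F (e := e) (3 * p + 6) fun B => val B (1 - f) = 1 - val B f := by
  refine ((forced_sub (f := 1) (by simp) hf).and (forced_one (k := 0))).imp fun B ⟨hsub, hone⟩ => ?_
  rw [hsub, hone]

end Prime

variable {ι : Type*} {s : Finset ι} {G H : ι → MvPolynomial V (ZMod p)} {m : ℕ}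

theorem forced_sum_eq_zero (hs : s.card ≤ 2 ^ m) (hG : ∀ x ∈ s, (G x).totalDegree ≤ e)
    (h : ∀ x ∈ s, ForcedOver F (e := e) k fun B => P B → val B (G x) = 0) :
    ForcedOver F (k + m + 6) fun B => P B → val B (∑ x ∈ s, G x) = 0 := by
  classical
  have chain : ForcedOver F (k + 3 + m * 1) fun B => P B → val B (∑ x ∈ (∅ : Finset ι), G x) = 0 →
      val B (∑ x ∈ s, G x) = 0 := by
    refine .finset_induction (Ψ := fun s' B => val B (∑ x ∈ s', G x) = 0)
      (fun s' => decidedBy_val (∑ x ∈ s', G x) (· = 0)) hs fun x s' hx hsub => ?_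
    have hxs := hsub (Finset.mem_insert_self x s')
    have hs' : (∑ y ∈ s', G y).totalDegree ≤ e :=
      totalDegree_finsetSum_le fun y hy => hG y (hsub (Finset.mem_insert_of_mem hy))
    refine ((h x hxs).and (forced_add (k := 0) (hG x hxs) hs')).imp
      fun B ⟨hzero, hadd⟩ hP hsum => ?_
    rw [Finset.sum_insert hx, hadd, hzero hP, hsum, add_zero]
  exact (chain.and (forced_zero (k := 0))).mono (by omega) fun B ⟨hB, hzero⟩ hP => hB hP hzero

theorem forced_sum_of_proportional {q : MvPolynomial V (ZMod p)} (hs : s.card ≤ 2 ^ m)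
    (hG : ∀ x ∈ s, (G x).totalDegree ≤ e) (hH : ∀ x ∈ s, (H x).totalDegree ≤ e)
    (h : ∀ x ∈ s, ForcedOver F (e := e) k fun B => val B (G x) = val B q * val B (H x)) :
    ForcedOver F (e := e) (k + 3 * m + 9) fun B =>
      val B (∑ x ∈ s, G x) = val B q * val B (∑ x ∈ s, H x) := by
  classical
  have chain : ForcedOver F (e := e) (k + 6 + m * 3) fun B => True →
      val B (∑ x ∈ (∅ : Finset ι), G x) = val B q * val B (∑ x ∈ (∅ : Finset ι), H x) →
        val B (∑ x ∈ s, G x) = val B q * val B (∑ x ∈ s, H x) := by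
    refine .finset_induction
      (Ψ := fun s' B => val B (∑ x ∈ s', G x) = val B q * val B (∑ x ∈ s', H x))
      (fun s' => ⟨[toLow e (∑ x ∈ s', G x), toLow e q, toLow e (∑ x ∈ s', H x)], le_rfl, ?_⟩) hs
      fun x s' hx hsub => ?_
    · intro B B' hB hΨ
      simp only [List.forall_mem_cons] at hB
      simpa only [val, hB] using hΨ
    · have hxs := hsub (Finset.mem_insert_self x s')
      have hmem : ∀ y ∈ s', y ∈ s := fun y hy => hsub (Finset.mem_insert_of_mem hy)
      have hGsum := forced_add (F := F) (k := 0) (hG x hxs)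
        (totalDegree_finsetSum_le fun y hy => hG y (hmem y hy))
      have hHsum := forced_add (F := F) (k := 0) (hH x hxs)
        (totalDegree_finsetSum_le fun y hy => hH y (hmem y hy))
      refine (((h x hxs).and hGsum).and hHsum).imp
        fun B ⟨⟨hterm, hGadd⟩, hHadd⟩ _ hsum => ?_
      rw [Finset.sum_insert hx, Finset.sum_insert hx, hGadd, hHadd, hterm, hsum, mul_add]
  refine (chain.and (forced_zero (k := 0))).mono (by omega) fun B ⟨hB, hzero⟩ => hB trivial ?_
  simp [hzero]

end Values

/-! ### Products -/

section Products

open MvPolynomial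

variable {p : ℕ} [Fact p.Prime] {V : Type u} {F : Finset (MvPolynomial V (ZMod p))} {e : ℕ}
  {f g : MvPolynomial V (ZMod p)}

theorem totalDegree_monomial_coeff_le {a : V →₀ ℕ} (ha : a ∈ f.support) :
    (monomial a (f.coeff a)).totalDegree ≤ f.totalDegree :=
  (totalDegree_monomial_le_degree _ _).trans (le_totalDegree ha)

theorem forced_monomial_mul_monomial {a b : V →₀ ℕ} (h : a.degree + b.degree ≤ e)
    (c d : ZMod p) :
    ForcedOver F (e := e) (9 * p + 9) fun B =>
      val B (monomial a c * monomial b d) = val B (monomial a c) * val B (monomial b d) := by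
  have split (m : V →₀ ℕ) (c : ZMod p) : monomial m c = C c * monomial m 1 := by
    rw [C_mul_monomial, mul_one]
  have hdeg (m : V →₀ ℕ) (hm : m.degree ≤ e) : (monomial m (1 : ZMod p)).totalDegree ≤ e :=
    (totalDegree_monomial_le_degree m 1).trans hm
  have hab : (a + b).degree ≤ e := by simpa using h
  refine ((((forced_C_mul (hdeg a (by omega)) c).and (forced_C_mul (hdeg b (by omega)) d)).and
    (forced_C_mul (hdeg (a + b) hab) (c * d))).and
    (forced_monomial_add (k := 0) h)).mono (by omega) fun B ⟨⟨⟨hc, hd⟩, hcd⟩, hmul⟩ => ?_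
  rw [monomial_mul, split, split a, split b, hc, hd, hcd, hmul]
  ring

theorem forced_monomial_mul {m : ℕ} (hg : g.support.card ≤ 2 ^ m) {a : V →₀ ℕ}
    (h : a.degree + g.totalDegree ≤ e) (c : ZMod p) :
    ForcedOver F (e := e) (9 * p + 3 * m + 18) fun B =>
      val B (monomial a c * g) = val B (monomial a c) * val B g := by
  have hmul {b : V →₀ ℕ} (hb : b ∈ g.support) : a.degree + b.degree ≤ e :=
    (Nat.add_le_add_left (le_totalDegree hb) _).trans h
  have main := forced_sum_of_proportional (F := F) (e := e) (k := 9 * p + 9)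
    (q := monomial a c) (G := fun b => monomial a c * monomial b (g.coeff b))
    (H := fun b => monomial b (g.coeff b)) hg
    (fun b hb => by
      rw [monomial_mul]
      exact (totalDegree_monomial_le_degree _ _).trans
        ((map_add Finsupp.degree a b).trans_le (hmul hb)))
    (fun b hb => (totalDegree_monomial_coeff_le hb).trans (by omega))
    fun b hb => forced_monomial_mul_monomial (hmul hb) c _
  rw [← Finset.mul_sum, support_sum_monomial_coeff] at main
  exact main.le (by omega)

theorem forced_mul {m : ℕ} (hf : f.support.card ≤ 2 ^ m) (hg : g.support.card ≤ 2 ^ m)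
    (h : f.totalDegree + g.totalDegree ≤ e) :
    ForcedOver F (e := e) (9 * p + 6 * m + 27) fun B => val B (f * g) = val B f * val B g := by
  have main := forced_sum_of_proportional (F := F) (e := e) (k := 9 * p + 3 * m + 18)
    (q := g) (G := fun a => monomial a (f.coeff a) * g) (H := fun a => monomial a (f.coeff a)) hf
    (fun a ha => (totalDegree_mul _ _).trans
      ((Nat.add_le_add_right (totalDegree_monomial_coeff_le ha) _).trans h))
    (fun a ha => (totalDegree_monomial_coeff_le ha).trans (by omega))
    fun a ha => (forced_monomial_mul hg
      ((Nat.add_le_add_right (le_totalDegree ha) _).trans h) _).imp fun B hB => by rw [hB, mul_comm]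
  rw [← Finset.sum_mul, support_sum_monomial_coeff] at main
  exact main.mono (by omega) fun B hB => hB.trans (mul_comm _ _)

theorem card_support_le [Fintype V] {H M : ℕ} (hV : Fintype.card V + 1 ≤ 2 ^ H)
    (hf : f.totalDegree ≤ M) : f.support.card ≤ 2 ^ (H * M) := by
  let word (m : V →₀ ℕ) (i : Fin M) : Option V := m.toMultiset.toList[(i : ℕ)]?
  have hword : Set.InjOn word f.support := fun m hm m' hm' h => by
    have hlen {m : V →₀ ℕ} (hm : m ∈ f.support) : m.toMultiset.toList.length ≤ M := by
      rw [Multiset.length_toList, Finsupp.card_toMultiset]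
      exact (le_totalDegree hm).trans hf
    have hlist : m.toMultiset.toList = m'.toMultiset.toList := List.ext_getElem? fun i => by
      rcases lt_or_ge i M with hi | hi
      · exact congrFun h ⟨i, hi⟩
      · rw [List.getElem?_eq_none ((hlen hm).trans hi),
          List.getElem?_eq_none ((hlen hm').trans hi)]
    classical
    apply Multiset.toFinsupp.symm.injective
    change m.toMultiset = m'.toMultiset
    rw [← Multiset.coe_toList m.toMultiset, hlist, Multiset.coe_toList]
  calc f.support.card ≤ (Finset.univ : Finset (Fin M → Option V)).card :=
        Finset.card_le_card_of_injOn word (by simp) hword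
    _ = (Fintype.card V + 1) ^ M := by simp
    _ ≤ (2 ^ H) ^ M := Nat.pow_le_pow_left hV M
    _ = 2 ^ (H * M) := (pow_mul _ _ _).symm

/-- Number of queries that force a product rule for polynomials of degree at most `M` in fewer
than `2 ^ H` variables: `9 p + 6 H M + 27` for one product, and `3` for verifying a label. -/
def mulCost (p H M : ℕ) : ℕ := 9 * p + 6 * (H * M) + 30

variable [Fintype V] {H M : ℕ}

theorem forced_prod (hV : Fintype.card V + 1 ≤ 2 ^ H) (hM : 2 * M ≤ e) {N : ℕ} {ι : Type*}
    {G : ι → MvPolynomial V (ZMod p)} (s : Finset ι) (hG : ∀ x ∈ s, (G x).totalDegree ≤ N)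
    (hs : s.card * N ≤ M) :
    ForcedOver F (e := e) (s.card * mulCost p H M) fun B =>
      val B (∏ x ∈ s, G x) = ∏ x ∈ s, val B (G x) := by
  classical
  induction s using Finset.induction_on with
  | empty => simpa using forced_one
  | insert x s hx ih =>
    simp only [Finset.card_insert_of_notMem hx, Finset.forall_mem_insert, add_mul,
      one_mul] at hG hs ⊢
    have hprod : (∏ y ∈ s, G y).totalDegree ≤ s.card * N :=
      (totalDegree_finsetProd _ _).trans (Finset.sum_le_card_nsmul _ _ _ hG.2)
    obtain ⟨hxN, hsN⟩ := hG
    have hmul : ForcedOver F (e := e) (9 * p + 6 * (H * M) + 27) fun B =>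
        val B (G x * ∏ y ∈ s, G y) = val B (G x) * val B (∏ y ∈ s, G y) :=
      forced_mul (card_support_le hV (by omega)) (card_support_le hV (by omega)) (by omega)
    refine ((ih hsN (by omega)).and hmul).mono (by rw [mulCost]; omega) fun B ⟨hprod, hmul⟩ => ?_
    rw [Finset.prod_insert hx, Finset.prod_insert hx, hmul, hprod]

theorem forced_pow (hV : Fintype.card V + 1 ≤ 2 ^ H) (hM : 2 * M ≤ e) {N : ℕ}
    (hf : f.totalDegree ≤ N) {n : ℕ} (hn : n * N ≤ M) :
    ForcedOver F (e := e) (n * mulCost p H M) fun B => val B (f ^ n) = val B f ^ n := by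
  simpa using forced_prod (F := F) hV hM (G := fun _ => f) (Finset.univ : Finset (Fin n))
    (fun _ _ => hf) (by simpa using hn)

end Products

/-! ### Subformulas and disjuncts -/

namespace Formula

variable {p : ℕ} {V : Type u} {a φ ψ : Formula p V} {φs : List (Formula p V)}

@[elab_as_elim]
theorem induction {C : Formula p V → Prop} (var : ∀ x, C (var x)) (neg : ∀ φ, C φ → C (neg φ))
    (or : ∀ φs, (∀ φ ∈ φs, C φ) → C (or φs)) (mod : ∀ i φs, (∀ φ ∈ φs, C φ) → C (mod i φs))
    (φ : Formula p V) : C φ :=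
  Formula.rec (motive_1 := C) (motive_2 := fun φs => ∀ φ ∈ φs, C φ) var neg or mod (by simp)
    (fun _ _ hφ hφs => List.forall_mem_cons.2 ⟨hφ, hφs⟩) φ

mutual
/-- The disjuncts of the outermost block of disjunctions. -/
def flat : Formula p V → List (Formula p V)
  | or φs => flatAll φs
  | φ => [φ]
/-- The concatenation of the lists of disjuncts. -/
def flatAll : List (Formula p V) → List (Formula p V)
  | [] => []
  | φ :: φs => flat φ ++ flatAll φs
end

open scoped Classical in
/-- The disjuncts of `⋁ φs` when the outermost block of disjunctions is read as one connective. -/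
noncomputable def disjuncts (φs : List (Formula p V)) : Finset (Formula p V) :=
  (flatAll φs).toFinset

mutual
/-- All subformulas, including the formula itself. -/
def subs : Formula p V → List (Formula p V)
  | var x => [var x]
  | neg φ => neg φ :: subs φ
  | or φs => or φs :: subsAll φs
  | mod i φs => mod i φs :: subsAll φs
/-- All subformulas of the members of the list. -/
def subsAll : List (Formula p V) → List (Formula p V)
  | [] => []
  | φ :: φs => subs φ ++ subsAll φs
end

theorem mem_flatAll : a ∈ flatAll φs ↔ ∃ φ ∈ φs, a ∈ flat φ := by
  induction φs with
  | nil => simp [flatAll]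
  | cons φ φs ih => simp [flatAll, ih]

theorem mem_disjuncts : a ∈ disjuncts φs ↔ ∃ φ ∈ φs, a ∈ flat φ := by
  simp only [disjuncts, List.mem_toFinset, mem_flatAll]

theorem mem_subsAll : a ∈ subsAll φs ↔ ∃ φ ∈ φs, a ∈ subs φ := by
  induction φs with
  | nil => simp [subsAll]
  | cons φ φs ih => simp [subsAll, ih]

theorem mem_subs_self (φ : Formula p V) : φ ∈ subs φ := by
  cases φ <;> simp [subs]

theorem mem_subs_neg (h : ψ ∈ subs φ) : ψ ∈ subs (neg φ) := List.mem_cons_of_mem _ h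

theorem mem_subs_or (hφ : φ ∈ φs) (h : ψ ∈ subs φ) : ψ ∈ subs (or φs) :=
  List.mem_cons_of_mem _ (mem_subsAll.2 ⟨φ, hφ, h⟩)

theorem mem_subs_mod {i : ZMod p} (hφ : φ ∈ φs) (h : ψ ∈ subs φ) : ψ ∈ subs (mod i φs) :=
  List.mem_cons_of_mem _ (mem_subsAll.2 ⟨φ, hφ, h⟩)

theorem le_of_mem_subs {α : Type*} [Preorder α] (μ : Formula p V → α)
    (neg : ∀ φ, μ φ ≤ μ (neg φ)) (or : ∀ φs, ∀ φ ∈ φs, μ φ ≤ μ (or φs))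
    (mod : ∀ i φs, ∀ φ ∈ φs, μ φ ≤ μ (mod i φs)) (h : ψ ∈ subs φ) : μ ψ ≤ μ φ := by
  induction φ using induction with
  | var x => rw [List.mem_singleton.1 h]
  | neg φ ih =>
    rcases List.mem_cons.1 h with rfl | h
    exacts [le_rfl, (ih h).trans (neg φ)]
  | or φs ih =>
    rcases List.mem_cons.1 h with rfl | h
    · rfl
    · obtain ⟨φ, hφ, h⟩ := mem_subsAll.1 h
      exact (ih φ hφ h).trans (or φs φ hφ)
  | mod i φs ih =>
    rcases List.mem_cons.1 h with rfl | h
    · rfl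
    · obtain ⟨φ, hφ, h⟩ := mem_subsAll.1 h
      exact (ih φ hφ h).trans (mod i φs φ hφ)

theorem mem_subs_trans (hψ : ψ ∈ subs φ) (ha : a ∈ subs ψ) : a ∈ subs φ :=
  le_of_mem_subs (fun φ => {a | a ∈ subs φ}) (fun _ _ => mem_subs_neg)
    (fun _ _ hφ _ => mem_subs_or hφ) (fun _ _ _ hφ _ => mem_subs_mod hφ) hψ ha

theorem size_le_sizeSum (h : φ ∈ φs) : φ.size ≤ sizeSum φs := by
  induction φs with
  | nil => simp at h
  | cons ψ φs ih =>
    rw [sizeSum]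
    rcases List.mem_cons.1 h with rfl | h
    exacts [Nat.le_add_right _ _, (ih h).trans (Nat.le_add_left _ _)]

theorem depth_le_depthMax (h : φ ∈ φs) : φ.depth ≤ depthMax φs := by
  induction φs with
  | nil => simp at h
  | cons ψ φs ih =>
    rw [depthMax]
    rcases List.mem_cons.1 h with rfl | h
    exacts [le_max_left _ _, (ih h).trans (le_max_right _ _)]

theorem le_depthUnderOr (h : φ ∈ φs) :
    (if φ.IsOr then φ.depth else φ.depth + 1) ≤ depthUnderOr φs := by
  induction φs with
  | nil => simp at h
  | cons ψ φs ih =>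
    rw [depthUnderOr]
    rcases List.mem_cons.1 h with rfl | h
    exacts [le_max_left _ _, (ih h).trans (le_max_right _ _)]

theorem depth_le_depth_neg (φ : Formula p V) : φ.depth ≤ (neg φ).depth := by
  rw [depth]; split <;> omega

theorem depth_le_depth_or (h : φ ∈ φs) : φ.depth ≤ (or φs).depth := by
  have := le_depthUnderOr h
  rw [depth]; split at this <;> omega

theorem depth_lt_depth_mod {i : ZMod p} (h : φ ∈ φs) : φ.depth < (mod i φs).depth :=
  Nat.lt_succ_iff.2 (depth_le_depthMax h)

theorem depth_le_of_mem_subs (h : ψ ∈ subs φ) : ψ.depth ≤ φ.depth :=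
  le_of_mem_subs depth depth_le_depth_neg (fun _ _ => depth_le_depth_or)
    (fun _ _ _ h => (depth_lt_depth_mod h).le) h

theorem size_lt_size_or (h : φ ∈ φs) : φ.size < (or φs).size :=
  Nat.lt_succ_iff.2 (size_le_sizeSum h)

theorem size_lt_size_mod {i : ZMod p} (h : φ ∈ φs) : φ.size < (mod i φs).size :=
  Nat.lt_succ_iff.2 (size_le_sizeSum h)

theorem size_le_of_mem_subs (h : ψ ∈ subs φ) : ψ.size ≤ φ.size :=
  le_of_mem_subs size (fun _ => Nat.le_succ _) (fun _ _ h => (size_lt_size_or h).le)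
    (fun _ _ _ h => (size_lt_size_mod h).le) h

theorem length_subs (φ : Formula p V) : (subs φ).length = φ.size := by
  have list (φs : List (Formula p V)) (h : ∀ φ ∈ φs, (subs φ).length = φ.size) :
      (subsAll φs).length = sizeSum φs := by
    induction φs with
    | nil => rfl
    | cons φ φs ih =>
      rw [List.forall_mem_cons] at h
      rw [subsAll, sizeSum, List.length_append, h.1, ih h.2]
  induction φ using induction with
  | var x => rfl
  | neg φ ih => rw [subs, size, List.length_cons, ih]
  | or φs ih => rw [subs, size, List.length_cons, list φs ih]
  | mod i φs ih => rw [subs, size, List.length_cons, list φs ih]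

theorem mem_subs_of_mem_flat (h : a ∈ flat φ) : a ∈ subs φ := by
  induction φ using induction with
  | or φs ih =>
    obtain ⟨φ, hφ, h⟩ := mem_flatAll.1 h
    exact mem_subs_or hφ (ih φ hφ h)
  | _ => rw [List.mem_singleton.1 h]; exact mem_subs_self _

theorem mem_subs_of_mem_disjuncts (h : a ∈ disjuncts φs) : a ∈ subs (or φs) := by
  obtain ⟨φ, hφ, h⟩ := mem_disjuncts.1 h
  exact mem_subs_or hφ (mem_subs_of_mem_flat h)

theorem size_lt_of_mem_disjuncts (h : a ∈ disjuncts φs) : a.size < (or φs).size := by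
  obtain ⟨φ, hφ, h⟩ := mem_disjuncts.1 h
  exact (size_le_of_mem_subs (mem_subs_of_mem_flat h)).trans_lt (size_lt_size_or hφ)

theorem depth_of_mem_flat (h : a ∈ flat φ) :
    (if φ.IsOr then a.depth + 1 else a.depth) ≤ φ.depth := by
  induction φ using induction with
  | or φs ih =>
    obtain ⟨φ, hφ, h⟩ := mem_flatAll.1 h
    have hle := ih φ hφ h
    have hor := le_depthUnderOr hφ
    rw [if_pos (show (or φs).IsOr = true from rfl), depth]
    refine le_trans ?_ (le_max_right _ _)
    split_ifs at hle hor <;> omega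
  | _ => rw [List.mem_singleton.1 h]; exact le_rfl

theorem depth_lt_of_mem_disjuncts (h : a ∈ disjuncts φs) : a.depth < (or φs).depth :=
  depth_of_mem_flat (φ := or φs) (mem_flatAll.2 (mem_disjuncts.1 h))

@[elab_as_elim]
theorem disjunct_induction {C : Formula p V → Prop} (var : ∀ x, C (var x))
    (neg : ∀ φ, C φ → C (neg φ)) (or : ∀ φs, (∀ a ∈ disjuncts φs, C a) → C (or φs))
    (mod : ∀ i φs, (∀ φ ∈ φs, C φ) → C (mod i φs)) (φ : Formula p V) : C φ := by
  have single {φ : Formula p V} (h : C φ) : C φ ∧ ∀ a ∈ [φ], C a :=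
    ⟨h, by simpa only [List.forall_mem_singleton]⟩
  suffices h : C φ ∧ ∀ a ∈ flat φ, C a from h.1
  induction φ using induction with
  | var x => exact single (var x)
  | neg φ ih => exact single (neg φ ih.1)
  | mod i φs ih => exact single (mod i φs fun φ hφ => (ih φ hφ).1)
  | or φs ih =>
    have hflat : ∀ a ∈ flatAll φs, C a := fun a ha => by
      obtain ⟨φ, hφ, ha⟩ := mem_flatAll.1 ha
      exact (ih φ hφ).2 a ha
    exact ⟨or φs fun a ha => hflat a (mem_flatAll.2 (mem_disjuncts.1 ha)), hflat⟩

end Formula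

/-! ### Polynomial approximations of formulas -/

section Approximation

open MvPolynomial Formula

variable {p h : ℕ} {V : Type u}

/-- Razborov–Smolensky approximation of a formula by a polynomial over `𝔽_p`.  A disjunction is
approximated by means of `h` linear combinations of its disjuncts; `ρ` lists their coefficients,
`ρ (⋁ φs) i a` being the coefficient of the disjunct `a` in the `i`-th combination for `⋁ φs`. -/
noncomputable def hat (ρ : Formula p V → Fin h → Formula p V → ZMod p) :
    Formula p V → MvPolynomial V (ZMod p)
  | .var x => X x
  | .neg φ => 1 - hat ρ φ
  | .or φs => 1 - ∏ i, (1 - (∑ a ∈ (disjuncts φs).attach, C (ρ (.or φs) i a) * hat ρ a) ^ (p - 1))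
  | .mod i φs => 1 - ((φs.attach.map fun φ => hat ρ φ.1).sum - C i) ^ (p - 1)
termination_by φ => φ.size
decreasing_by
  exacts [Nat.lt_succ_self _, size_lt_of_mem_disjuncts a.2, size_lt_size_mod φ.2]

variable {ρ ρ' : Formula p V → Fin h → Formula p V → ZMod p} {φ : Formula p V}
  {φs : List (Formula p V)}

variable (ρ) in
/-- The `i`-th linear combination of the disjuncts of `⋁ φs`. -/
noncomputable def comb (φs : List (Formula p V)) (i : Fin h) : MvPolynomial V (ZMod p) :=
  ∑ a ∈ disjuncts φs, C (ρ (.or φs) i a) * hat ρ a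

theorem hat_var (x : V) : hat ρ (.var x) = X x := by rw [hat]

theorem hat_neg (φ : Formula p V) : hat ρ (.neg φ) = 1 - hat ρ φ := by rw [hat]

theorem hat_or (φs : List (Formula p V)) :
    hat ρ (.or φs) = 1 - ∏ i, (1 - comb ρ φs i ^ (p - 1)) := by
  have hsum (i : Fin h) : ∑ a ∈ (disjuncts φs).attach, C (ρ (.or φs) i a) * hat ρ a =
      comb ρ φs i := Finset.sum_attach _ fun a => C (ρ (.or φs) i a) * hat ρ a
  simp only [hat, hsum]

theorem hat_mod (i : ZMod p) (φs : List (Formula p V)) :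
    hat ρ (.mod i φs) = 1 - ((φs.map (hat ρ)).sum - C i) ^ (p - 1) := by
  rw [hat, List.attach_map_val (f := hat ρ)]

theorem hat_congr (hρ : ∀ ψ ∈ subs φ, ρ ψ = ρ' ψ) : hat ρ φ = hat ρ' φ := by
  induction φ using disjunct_induction with
  | var x => rw [hat_var, hat_var]
  | neg φ ih => rw [hat_neg, hat_neg, ih fun ψ hψ => hρ ψ (mem_subs_neg hψ)]
  | or φs ih =>
    have hcomb (i : Fin h) : comb ρ φs i = comb ρ' φs i := Finset.sum_congr rfl fun a ha => by
      rw [hρ _ (mem_subs_self _),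
        ih a ha fun ψ hψ => hρ ψ (mem_subs_trans (mem_subs_of_mem_disjuncts ha) hψ)]
    simp only [hat_or, hcomb]
  | mod i φs ih =>
    rw [hat_mod, hat_mod, List.map_congr_left fun φ hφ =>
      ih φ hφ fun ψ hψ => hρ ψ (mem_subs_mod hφ hψ)]

theorem totalDegree_one_sub_le {M : ℕ} {f : MvPolynomial V (ZMod p)} (hf : f.totalDegree ≤ M) :
    (1 - f).totalDegree ≤ M :=
  (totalDegree_sub _ _).trans (max_le (by simp) hf)

theorem totalDegree_one_sub_pow_le {M : ℕ} {f : MvPolynomial V (ZMod p)}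
    (hf : f.totalDegree ≤ M) : (1 - f ^ (p - 1)).totalDegree ≤ p * M :=
  totalDegree_one_sub_le ((totalDegree_pow _ _).trans (Nat.mul_le_mul (Nat.sub_le p 1) hf))

theorem totalDegree_listSum_le {M : ℕ} {l : List (MvPolynomial V (ZMod p))}
    (hl : ∀ f ∈ l, f.totalDegree ≤ M) : l.sum.totalDegree ≤ M :=
  (mem_restrictTotalDegree ..).1
    (list_sum_mem fun f hf => (mem_restrictTotalDegree ..).2 (hl f hf))

theorem totalDegree_comb_le {M : ℕ} (hM : ∀ a ∈ disjuncts φs, (hat ρ a).totalDegree ≤ M)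
    (i : Fin h) : (comb ρ φs i).totalDegree ≤ M :=
  totalDegree_finsetSum_le fun a ha =>
    (totalDegree_mul _ _).trans (by simpa only [totalDegree_C, zero_add] using hM a ha)

theorem totalDegree_hat_le (hp : 1 ≤ h * p) (φ : Formula p V) :
    (hat ρ φ).totalDegree ≤ (h * p) ^ φ.depth := by
  induction φ using disjunct_induction with
  | var x =>
    rw [hat_var, X]
    exact (totalDegree_monomial_le_degree _ _).trans (by simp [depth])
  | neg φ ih =>
    rw [hat_neg]
    exact totalDegree_one_sub_le (ih.trans (Nat.pow_le_pow_right hp (depth_le_depth_neg φ)))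
  | or φs ih =>
    obtain ⟨k, hk⟩ : ∃ k, (or φs).depth = k + 1 :=
      Nat.exists_eq_add_of_le' (by rw [depth]; exact le_max_left _ _)
    have hcomb := totalDegree_comb_le (ρ := ρ) (M := (h * p) ^ k) fun a ha =>
      (ih a ha).trans (Nat.pow_le_pow_right hp (by have := depth_lt_of_mem_disjuncts ha; omega))
    rw [hat_or, hk]
    refine totalDegree_one_sub_le ((totalDegree_finsetProd _ _).trans ?_)
    refine (Finset.sum_le_card_nsmul _ _ _ fun i _ =>
      totalDegree_one_sub_pow_le (hcomb i)).trans_eq ?_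
    simp only [Finset.card_univ, Fintype.card_fin, smul_eq_mul]
    ring
  | mod i φs ih =>
    have hsum : ((φs.map (hat ρ)).sum - C i).totalDegree ≤ (h * p) ^ depthMax φs := by
      refine (totalDegree_sub _ _).trans (max_le (totalDegree_listSum_le ?_) (by simp))
      simp only [List.forall_mem_map]
      exact fun φ hφ => (ih φ hφ).trans (Nat.pow_le_pow_right hp (depth_le_depthMax hφ))
    rw [hat_mod, depth, pow_succ, mul_comm _ (h * p)]
    exact (totalDegree_one_sub_pow_le hsum).trans
      (Nat.mul_le_mul_right _ (Nat.le_mul_of_pos_left p (Nat.pos_of_mul_pos_right hp)))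

end Approximation

/-! ### Truth values -/

section Truth

open MvPolynomial Formula

variable {p h : ℕ} {V : Type u} {e : ℕ}

/-- The truth value that `B` assigns to a formula: true if the value of the approximation of the
formula is not zero. -/
def Holds (ρ : Formula p V → Fin h → Formula p V → ZMod p) (B : LowDeg p V e → ZMod p)
    (φ : Formula p V) : Prop :=
  val B (hat ρ φ) ≠ 0

/-- The coefficients `ρ` hide from `B` that the disjunct `a` of `⋁ φs` is true: all linear
combinations have value `0` (this is the case `c = 0`), and `B` is linear on the lines through
them in direction `hat ρ a`. -/
def Hides (ρ : Formula p V → Fin h → Formula p V → ZMod p) (B : LowDeg p V e → ZMod p)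
    (φs : List (Formula p V)) (a : Formula p V) : Prop :=
  Holds ρ B a ∧ ∀ i c, val B (comb ρ φs i + C c * hat ρ a) = c * val B (hat ρ a)

/-- The coefficients `ρ` hide no disjunct of a disjunction in `R` from `B`. -/
def Good (ρ : Formula p V → Fin h → Formula p V → ZMod p) (R : Finset (Formula p V))
    (B : LowDeg p V e → ZMod p) : Prop :=
  ∀ φs, .or φs ∈ R → ∀ a ∈ disjuncts φs, ¬ Hides ρ B φs a

/-- Numerical conditions under which products occurring in the approximations of formulas of
depth at most `d` are polynomials of degree at most `e`. -/
structure Budget (p : ℕ) (V : Type u) [Fintype V] (h H d e : ℕ) : Prop where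
  card_le : Fintype.card V + 1 ≤ 2 ^ H
  one_le : 1 ≤ h
  degree_le : 2 * (h * p) ^ (d + 1) ≤ e

/-- A number of queries that suffices for each basic property of the truth values of formulas of
depth at most `d` whose disjunctions have at most `2 ^ L` disjuncts. -/
def unitCost (p h H L d : ℕ) : ℕ := 5 * (h * (p * mulCost p H ((h * p) ^ (d + 1)))) + L

variable [Fact p.Prime] [Fintype V] {F : Finset (MvPolynomial V (ZMod p))} {H L d k : ℕ}
  {ρ : Formula p V → Fin h → Formula p V → ZMod p} {φ : Formula p V} {φs : List (Formula p V)}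
  {f : MvPolynomial V (ZMod p)}

namespace Budget

variable (hb : Budget p V h H d e)

include hb

theorem hp_pos : 1 ≤ h * p := Nat.mul_pos hb.one_le (Fact.out : p.Prime).pos

theorem totalDegree_le (hf : f.totalDegree ≤ (h * p) ^ (d + 1)) : f.totalDegree ≤ e :=
  (hf.trans (Nat.le_mul_of_pos_left _ two_pos)).trans hb.degree_le

theorem totalDegree_hat_le (hφ : φ.depth ≤ d) : (hat ρ φ).totalDegree ≤ (h * p) ^ d :=
  (ModFrege.totalDegree_hat_le hb.hp_pos φ).trans (Nat.pow_le_pow_right hb.hp_pos hφ)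

theorem totalDegree_le_of_le_pow (hf : f.totalDegree ≤ (h * p) ^ d) : f.totalDegree ≤ e :=
  hb.totalDegree_le (hf.trans (Nat.pow_le_pow_right hb.hp_pos d.le_succ))

theorem totalDegree_comb_le (hφs : (or φs).depth ≤ d) (i : Fin h) :
    (comb ρ φs i).totalDegree ≤ (h * p) ^ d :=
  ModFrege.totalDegree_comb_le (fun _ ha =>
    hb.totalDegree_hat_le ((depth_lt_of_mem_disjuncts ha).le.trans hφs)) i

omit [Fact p.Prime] in
theorem mul_pow_le : p * (h * p) ^ d ≤ (h * p) ^ (d + 1) := by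
  rw [pow_succ', mul_assoc]
  exact Nat.le_mul_of_pos_left _ hb.one_le

theorem le_unitCost :
    p * mulCost p H ((h * p) ^ (d + 1)) + h * mulCost p H ((h * p) ^ (d + 1)) +
      h * (p * mulCost p H ((h * p) ^ (d + 1)) + (3 * p + 12)) + h * (p * (3 * p + 6)) +
        h + 6 * p + 24 + L ≤ unitCost p h H L d := by
  have hp := (Fact.out : p.Prime).two_le
  have hh := hb.one_le
  rw [unitCost]
  set W := mulCost p H ((h * p) ^ (d + 1)) with hW
  have hpW : 9 * p + 30 ≤ W := by rw [hW, mulCost]; omega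
  have h₁ := Nat.mul_le_mul_left h (show 3 * p + 12 ≤ W by omega)
  have h₂ := Nat.mul_le_mul_left h (Nat.mul_le_mul_left p (show 3 * p + 6 ≤ W by omega))
  have h₃ : p * W ≤ h * (p * W) := Nat.le_mul_of_pos_left _ hh
  have h₄ : 2 * (h * W) ≤ h * (p * W) := by
    rw [mul_left_comm]
    exact Nat.mul_le_mul_left _ (Nat.mul_le_mul_right _ hp)
  have h₅ : W ≤ h * W := Nat.le_mul_of_pos_left _ hh
  have h₆ : h ≤ h * W := Nat.le_mul_of_pos_right _ (by omega)
  rw [mul_add]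
  omega

theorem forced_one_sub_pow (hf : f.totalDegree ≤ (h * p) ^ d) :
    ForcedOver F (e := e) (p * mulCost p H ((h * p) ^ (d + 1)) + 3 * p + 9) fun B =>
      val B (1 - f ^ (p - 1)) = 1 - val B f ^ (p - 1) := by
  have hpow := forced_pow (F := F) hb.card_le hb.degree_le hf (n := p - 1)
    ((Nat.mul_le_mul_right _ (Nat.sub_le p 1)).trans hb.mul_pow_le)
  have hdeg : (f ^ (p - 1)).totalDegree ≤ e :=
    hb.totalDegree_le <| ((totalDegree_pow _ _).trans
      (Nat.mul_le_mul (Nat.sub_le p 1) hf)).trans hb.mul_pow_le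
  refine (hpow.and (forced_one_sub hdeg)).mono ?_ fun B ⟨hpow, hsub⟩ => by rw [hsub, hpow]
  have := Nat.mul_le_mul_right (mulCost p H ((h * p) ^ (d + 1))) (Nat.sub_le p 1)
  omega

variable (ρ) in
theorem forced_hat_mod {i : ZMod p} (hφs : (mod i φs).depth ≤ d) :
    ForcedOver F (e := e) (unitCost p h H L d) fun B =>
      val B (hat ρ (.mod i φs)) = 1 - (val B (φs.map (hat ρ)).sum - i) ^ (p - 1) := by
  have hsum : (φs.map (hat ρ)).sum.totalDegree ≤ (h * p) ^ d := by
    refine totalDegree_listSum_le ?_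
    simp only [List.forall_mem_map]
    exact fun φ hφ => hb.totalDegree_hat_le ((depth_lt_depth_mod hφ).le.trans hφs)
  have hsub : ((φs.map (hat ρ)).sum - C i).totalDegree ≤ (h * p) ^ d :=
    (totalDegree_sub _ _).trans (max_le hsum (by simp))
  have hcost := hb.le_unitCost (L := L)
  refine (((hb.forced_one_sub_pow hsub).and (forced_sub (hb.totalDegree_le_of_le_pow hsum)
    (g := C i) (by simp))).and (forced_C (k := 0) i)).mono ?_
    fun B ⟨⟨hpow, hsub⟩, hC⟩ => by rw [hat_mod, hpow, hsub, hC]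
  omega

variable (ρ) in
theorem forced_hat_or (hφs : (or φs).depth ≤ d) :
    ForcedOver F (e := e) (unitCost p h H L d) fun B =>
      val B (hat ρ (.or φs)) = 1 - ∏ i, (1 - val B (comb ρ φs i) ^ (p - 1)) := by
  have hcomb := hb.totalDegree_comb_le (ρ := ρ) hφs
  have hfactor (i : Fin h) (_ : i ∈ Finset.univ) := totalDegree_one_sub_pow_le (hcomb i)
  have hM : (Finset.univ : Finset (Fin h)).card * (p * (h * p) ^ d) = (h * p) ^ (d + 1) := by
    rw [Finset.card_univ, Fintype.card_fin, pow_succ', mul_assoc]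
  have hprod : (∏ i, (1 - comb ρ φs i ^ (p - 1))).totalDegree ≤ e :=
    hb.totalDegree_le <| ((totalDegree_finsetProd _ _).trans
      (Finset.sum_le_card_nsmul _ _ _ hfactor)).trans_eq hM
  have hcost := hb.le_unitCost (L := L)
  refine (((forced_prod hb.card_le hb.degree_le _ hfactor hM.le).and (forced_one_sub hprod)).and
    (Forced.forall_mem Finset.univ fun i _ => hb.forced_one_sub_pow (F := F) (hcomb i))).mono ?_
    fun B ⟨⟨hprod, hsub⟩, hpow⟩ => ?_
  · rw [Finset.card_univ, Fintype.card_fin]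
    rw [show ∀ x, x + 3 * p + 9 + 3 = x + (3 * p + 12) from fun x => by omega]
    omega
  · rw [hat_or, hsub, hprod, Finset.prod_congr rfl hpow]

theorem forced_hat_bool_of_bool (hφ : φ.depth ≤ d)
    (hbool : ForcedOver F (e := e) (unitCost p h H L d) fun B =>
      val B (hat ρ φ) = 0 ∨ val B (hat ρ φ) = 1) :
    ForcedOver F (e := e) (2 * unitCost p h H L d) fun B =>
      val B (hat ρ φ) = 0 ∧ val B (hat ρ (.neg φ)) = 1 ∨
        val B (hat ρ φ) = 1 ∧ val B (hat ρ (.neg φ)) = 0 := by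
  have hcost := hb.le_unitCost (L := L)
  refine (hbool.and (forced_one_sub (hb.totalDegree_le_of_le_pow
    (hb.totalDegree_hat_le (ρ := ρ) hφ)))).mono (by omega) fun B ⟨hB, hneg⟩ => ?_
  rw [hat_neg, hneg]
  rcases hB with hB | hB <;> simp [hB]

/-- The two alternatives are exchanged when `φ` is negated, which keeps the cost independent of
the number of negations in front of a formula. -/
theorem forced_hat_bool (hφ : φ.depth ≤ d) :
    ForcedOver F (e := e) (2 * unitCost p h H L d) fun B =>
      val B (hat ρ φ) = 0 ∧ val B (hat ρ (.neg φ)) = 1 ∨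
        val B (hat ρ φ) = 1 ∧ val B (hat ρ (.neg φ)) = 0 := by
  have hpow (x : ZMod p) : 1 - x ^ (p - 1) = 0 ∨ 1 - x ^ (p - 1) = 1 := by
    rw [ZMod.pow_card_sub_one]
    split <;> simp
  induction φ using induction with
  | var x =>
    refine hb.forced_hat_bool_of_bool hφ (hat_var (ρ := ρ) x ▸ forced_X ?_ x)
    have := hb.degree_le
    have := Nat.one_le_pow (d + 1) _ hb.hp_pos
    omega
  | neg φ ih =>
    refine (ih ((depth_le_depth_neg φ).trans hφ)).imp fun B hB => ?_
    rw [hat_neg (.neg φ), hat_neg φ, sub_sub_cancel, ← hat_neg φ]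
    exact hB.symm.imp And.symm And.symm
  | or φs =>
    refine hb.forced_hat_bool_of_bool hφ ((hb.forced_hat_or ρ hφ).imp fun B hB => ?_)
    have hprod : ∏ i, (1 - val B (comb ρ φs i) ^ (p - 1)) = 0 ∨
        ∏ i, (1 - val B (comb ρ φs i) ^ (p - 1)) = 1 :=
      Finset.prod_induction _ (fun z => z = 0 ∨ z = 1)
        (by rintro a b (rfl | rfl) (rfl | rfl) <;> simp) (.inr rfl) fun i _ => hpow _
    rw [hB]
    rcases hprod with h | h <;> simp [h]
  | mod i φs =>
    exact hb.forced_hat_bool_of_bool hφ ((hb.forced_hat_mod ρ hφ).imp fun B hB => hB ▸ hpow _)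

end Budget

end Truth

/-! ### Truth of compound formulas -/

section Connectives

open MvPolynomial Formula

variable {p : ℕ} {V : Type u}

/-- A set of formulas of depth at most `d` that is closed under subformulas and has at most `2 ^ L`
elements. -/
structure Admissible [Fintype V] (R : Finset (Formula p V)) (h H L d e : ℕ) : Prop
    extends Budget p V h H d e where
  mem_of_mem_subs : ∀ {φ ψ}, φ ∈ R → ψ ∈ subs φ → ψ ∈ R
  depth_le : ∀ {φ}, φ ∈ R → φ.depth ≤ d
  card_le_two_pow : R.card ≤ 2 ^ L

variable [Fact p.Prime] [Fintype V] {F : Finset (MvPolynomial V (ZMod p))}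
  {h H L d e k : ℕ} {ρ : Formula p V → Fin h → Formula p V → ZMod p} {R : Finset (Formula p V)}
  {P : (LowDeg p V e → ZMod p) → Prop} {φ ψ a : Formula p V} {φs : List (Formula p V)}

namespace Admissible

variable (hR : Admissible R h H L d e)

include hR

theorem le_unitCost : 3 * p + L + h + 12 ≤ unitCost p h H L d ∧ 24 ≤ unitCost p h H L d ∧
    h * p * (3 * p + 6) + 2 * h + 12 ≤ unitCost p h H L d := by
  have hcost := hR.toBudget.le_unitCost (L := L)
  refine ⟨by omega, by omega, ?_⟩
  have hp := (Fact.out : p.Prime).two_le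
  have hW : h * 2 ≤ h * mulCost p H ((h * p) ^ (d + 1)) :=
    Nat.mul_le_mul_left h (by rw [mulCost]; omega)
  rw [mul_assoc]
  omega

omit [Fact p.Prime] in
theorem card_disjuncts_le (hφs : or φs ∈ R) : (disjuncts φs).card ≤ 2 ^ L :=
  (Finset.card_le_card fun _ ha => hR.mem_of_mem_subs hφs (mem_subs_of_mem_disjuncts ha)).trans
    hR.card_le_two_pow

variable (ρ) in
theorem forced_neg (hφ : φ ∈ R) :
    ForcedOver F (e := e) (2 * unitCost p h H L d) fun B =>
      Holds ρ B (.neg φ) ↔ ¬ Holds ρ B φ := by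
  refine (hR.toBudget.forced_hat_bool (ρ := ρ) (hR.depth_le hφ)).imp fun B hB => ?_
  rcases hB with ⟨h₁, h₂⟩ | ⟨h₁, h₂⟩ <;> simp [Holds, h₁, h₂]

theorem forced_not_or_of_disjuncts (hφs : or φs ∈ R)
    (hk : ∀ a ∈ disjuncts φs, ForcedOver F k fun B => P B → ¬ Holds ρ B a) :
    ForcedOver F (k + 2 * unitCost p h H L d) fun B => P B → ¬ Holds ρ B (.or φs) := by
  have hp := (Fact.out : p.Prime).one_lt
  have hdeg {a} (ha : a ∈ disjuncts φs) : (hat ρ a).totalDegree ≤ e :=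
    hR.totalDegree_le_of_le_pow <| hR.totalDegree_hat_le <|
      hR.depth_le <| hR.mem_of_mem_subs hφs <| mem_subs_of_mem_disjuncts ha
  have hcomb (i : Fin h) :
      ForcedOver F (k + (3 * p + L + 9)) fun B => P B → val B (comb ρ φs i) = 0 := by
    refine (forced_sum_eq_zero (k := k + 3 * p + 3) (hR.card_disjuncts_le hφs) (fun a ha => ?_)
      fun a ha => ((hk a ha).and (forced_C_mul (hdeg ha) (ρ (.or φs) i a))).imp ?_).le (by omega)
    · exact (totalDegree_mul _ _).trans (by simpa using hdeg ha)
    · rintro B ⟨hB, hmul⟩ hP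
      rw [hmul, not_ne_iff.1 (hB hP), mul_zero]
  have hcost := hR.le_unitCost
  have hall := Forced.forall_of_decided Finset.univ
    (fun i _ => decidedBy_val (comb ρ φs i) (· = 0)) fun i _ => hcomb i
  refine (hall.and (hR.forced_hat_or ρ (L := L) (hR.depth_le hφs))).mono ?_
    fun B ⟨hall, hor⟩ hP => ?_
  · rw [Finset.card_univ, Fintype.card_fin]
    omega
  · rw [Holds, hor, Finset.prod_congr rfl fun i hi => by rw [hall hP i hi]]
    simp [Nat.sub_ne_zero_of_lt hp]

variable (ρ) in
/-- As the true disjunct `a` is not hidden, some combination is not zero. -/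
theorem forced_or_of_disjunct (hφs : or φs ∈ R) (ha : a ∈ disjuncts φs) :
    ForcedOver F (e := e) (2 * unitCost p h H L d) fun B =>
      Good ρ R B → Holds ρ B a → Holds ρ B (.or φs) := by
  have hlines := Forced.forall_mem (Finset.univ : Finset (Fin h × ZMod p)) fun ic _ =>
    forced_add_C_mul (F := F) (f := comb ρ φs ic.1) (g := hat ρ a)
      (hR.totalDegree_le_of_le_pow (hR.totalDegree_comb_le (hR.depth_le hφs) ic.1))
      (hR.totalDegree_le_of_le_pow (hR.totalDegree_hat_le
        (hR.depth_le (hR.mem_of_mem_subs hφs (mem_subs_of_mem_disjuncts ha))))) ic.2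
  have hcost := hR.le_unitCost
  refine (hlines.and (hR.forced_hat_or ρ (L := L) (hR.depth_le hφs))).mono ?_
    fun B ⟨hlines, hor⟩ hgood hBa => ?_
  · rw [Finset.card_univ, Fintype.card_prod, Fintype.card_fin, ZMod.card,
      show 3 * p + 3 + 3 = 3 * p + 6 by omega]
    omega
  · obtain ⟨i, hi⟩ : ∃ i, val B (comb ρ φs i) ≠ 0 := by
      by_contra! hzero
      refine hgood φs hφs a ha ⟨hBa, fun i c => ?_⟩
      rw [hlines (i, c) (Finset.mem_univ _), hzero, zero_add]
    rw [Holds, hor, Finset.prod_eq_zero (Finset.mem_univ i)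
      (by rw [ZMod.pow_card_sub_one_eq_one hi, sub_self]), sub_zero]
    exact one_ne_zero

variable (ρ) in
theorem forced_or_of_mem (hφs : or φs ∈ R) (hφ : φ ∈ φs) :
    ForcedOver F (e := e) (4 * unitCost p h H L d) fun B =>
      Good ρ R B → Holds ρ B φ → Holds ρ B (.or φs) := by
  have hdisj {a} (ha : a ∈ flat φ) := hR.forced_or_of_disjunct (F := F) ρ hφs
    (mem_disjuncts.2 ⟨φ, hφ, ha⟩)
  cases φ
  case or ψs =>
    have hψs : or ψs ∈ R := hR.mem_of_mem_subs hφs (mem_subs_or hφ (mem_subs_self _))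
    refine (hR.forced_not_or_of_disjuncts (ρ := ρ)
      (P := fun B => Good ρ R B ∧ ¬ Holds ρ B (.or φs)) hψs fun a ha =>
        (hdisj (mem_flatAll.2 (mem_disjuncts.1 ha))).imp ?_).mono (by omega) ?_
    · exact fun B hB ⟨hgood, hor⟩ ha => hor (hB hgood ha)
    · exact fun B hB hgood hψ => by_contra fun hor => hB ⟨hgood, hor⟩ hψ
  all_goals exact (hdisj (by simp [flat])).le (by omega)

theorem forced_not_or (hφs : or φs ∈ R) (hP : ∀ B, P B → Good ρ R B)
    (hk : ∀ φ ∈ φs, ForcedOver F k fun B => P B → ¬ Holds ρ B φ) :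
    ForcedOver F (k + 5 * unitCost p h H L d) fun B => P B → ¬ Holds ρ B (.or φs) := by
  have hcost := hR.le_unitCost
  refine (hR.forced_not_or_of_disjuncts (k := k + 3 * unitCost p h H L d) hφs fun a ha => ?_).le
    (by omega)
  obtain ⟨φ, hφ, ha⟩ := mem_disjuncts.1 ha
  have hφk := hk φ hφ
  cases φ
  case or ψs =>
    have hψs : or ψs ∈ R := hR.mem_of_mem_subs hφs (mem_subs_or hφ (mem_subs_self _))
    refine (hφk.and (hR.forced_or_of_disjunct ρ hψs (mem_disjuncts.2 (mem_flatAll.1 ha)))).mono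
      (by omega) ?_
    exact fun B ⟨hor, himp⟩ hP' ha => hor hP' (himp (hP B hP') ha)
  all_goals
    obtain rfl := List.mem_singleton.1 (by simpa [flat] using ha)
    exact hφk.le (by omega)

variable (ρ) in
theorem forced_or_iff (hφs : or φs ∈ R) :
    ForcedOver F (e := e) ((5 * φs.length + 6) * unitCost p h H L d) fun B =>
      Good ρ R B → (Holds ρ B (.or φs) ↔ ∃ φ ∈ φs, Holds ρ B φ) := by
  have hcost := hR.le_unitCost
  have hnot := hR.forced_not_or (F := F) (k := 0) hφs
    (P := fun B => Good ρ R B ∧ ∀ φ ∈ φs, ¬ Holds ρ B φ) (fun B hB => hB.1)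
    fun φ hφ => .of_forall fun B hB => hB.2 φ hφ
  refine ((Forced.forall_mem_list φs fun φ hφ => hR.forced_or_of_mem ρ hφs hφ).and hnot).mono
    ?_ fun B ⟨hmem, hnot⟩ hgood => ⟨fun h => ?_, fun ⟨φ, hφ, h⟩ => hmem φ hφ hgood h⟩
  · nlinarith [φs.length.zero_le]
  · by_contra! hall
    exact hnot ⟨hgood, hall⟩ h

variable (ρ) in
theorem forced_and_iff (hφs : Formula.and φs ∈ R) :
    ForcedOver F (e := e) ((8 * φs.length + 9) * unitCost p h H L d) fun B =>
      Good ρ R B → (Holds ρ B (.and φs) ↔ ∀ φ ∈ φs, Holds ρ B φ) := by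
  have hcost := hR.le_unitCost
  have hor : or (φs.map neg) ∈ R := hR.mem_of_mem_subs hφs (mem_subs_neg (mem_subs_self _))
  have hmem {φ} (hφ : φ ∈ φs) : φ ∈ R :=
    hR.mem_of_mem_subs hor (mem_subs_or (List.mem_map_of_mem hφ) (mem_subs_neg (mem_subs_self _)))
  refine (((hR.forced_or_iff ρ hor).and (hR.forced_neg ρ hor)).and
    (Forced.forall_mem_list φs fun φ hφ => hR.forced_neg ρ (hmem hφ))).mono ?_ ?_
  · rw [List.length_map]
    nlinarith [φs.length.zero_le]
  · rintro B ⟨⟨hor, hneg⟩, hφ⟩ hgood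
    rw [Formula.and, hneg, hor hgood]
    simp only [not_exists, not_and, List.forall_mem_map]
    exact forall₂_congr fun φ hφs => by rw [hφ φ hφs, not_not]

variable (ρ) in
theorem forced_iff (hiff : Formula.iff φ ψ ∈ R) :
    ForcedOver F (e := e) (62 * unitCost p h H L d) fun B =>
      Good ρ R B → (Holds ρ B (.iff φ ψ) ↔ (Holds ρ B φ ↔ Holds ρ B ψ)) := by
  have hcost := hR.le_unitCost
  have hsub {χ} (h : χ ∈ subs (Formula.iff φ ψ)) : χ ∈ R := hR.mem_of_mem_subs hiff h
  have hor₁ : or [neg φ, ψ] ∈ R := hsub (by simp [Formula.iff, Formula.and, subs, subsAll])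
  have hor₂ : or [neg ψ, φ] ∈ R := hsub (by simp [Formula.iff, Formula.and, subs, subsAll])
  have hφ : φ ∈ R := hR.mem_of_mem_subs hor₂ (by simp [subs, subsAll, mem_subs_self])
  have hψ : ψ ∈ R := hR.mem_of_mem_subs hor₁ (by simp [subs, subsAll, mem_subs_self])
  refine (((((hR.forced_and_iff ρ hiff).and (hR.forced_or_iff ρ hor₁)).and
    (hR.forced_or_iff ρ hor₂)).and (hR.forced_neg ρ hφ)).and (hR.forced_neg ρ hψ)).mono
    (by simp only [List.length_cons, List.length_nil]; omega) ?_
  rintro B ⟨⟨⟨⟨hand, hor₁⟩, hor₂⟩, hφ⟩, hψ⟩ hgood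
  simp [Formula.iff, hand hgood, hor₁ hgood, hor₂ hgood, hφ, hψ, ← imp_iff_not_or,
    iff_iff_implies_and_implies]

variable (ρ) in
theorem forced_mod {i : ZMod p} (hmod : mod i φs ∈ R) :
    ForcedOver F (e := e) (unitCost p h H L d) fun B =>
      Holds ρ B (.mod i φs) ↔ val B (φs.map (hat ρ)).sum = i := by
  refine (hR.forced_hat_mod ρ (hR.depth_le hmod)).imp fun B hB => ?_
  rw [Holds, hB, ZMod.pow_card_sub_one]
  simp [sub_eq_zero]

end Admissible

end Connectives

/-! ### Soundness of the rules -/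

section Rules

open MvPolynomial Formula

variable {p : ℕ} {V : Type u}

/-- The disjunction that expresses a sequent. -/
def Sequent.toFormula (S : Sequent p V) : Formula p V := .or (S.ante.map .neg ++ S.succ)

variable [Fact p.Prime] [Fintype V] {F : Finset (MvPolynomial V (ZMod p))}
  {h H L d e k l : ℕ} {ρ : Formula p V → Fin h → Formula p V → ZMod p} {R : Finset (Formula p V)}
  {P : (LowDeg p V e → ZMod p) → Prop} {S S' : Sequent p V} {Γ Δ φs : List (Formula p V)}
  {φ ψ χ : Formula p V}

namespace Admissible

variable (hR : Admissible R h H L d e)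

include hR

theorem forced_mod_append {i : ZMod p} (hi : mod i (Γ ++ [φ]) ∈ R) (hi₀ : mod i Γ ∈ R)
    (hi₁ : mod (i - 1) Γ ∈ R) :
    ForcedOver F (e := e) (6 * unitCost p h H L d) fun B =>
      Holds ρ B (.mod i (Γ ++ [φ])) ↔
        Holds ρ B (.mod i Γ) ∧ ¬ Holds ρ B φ ∨ Holds ρ B (.mod (i - 1) Γ) ∧ Holds ρ B φ := by
  have hcost := hR.le_unitCost
  have hφ : φ ∈ R := hR.mem_of_mem_subs hi (mem_subs_mod (by simp) (mem_subs_self _))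
  have hdeg {ψ} (hψ : ψ ∈ R) : (hat ρ ψ).totalDegree ≤ (h * p) ^ d :=
    hR.totalDegree_hat_le (hR.depth_le hψ)
  have hΓ : (Γ.map (hat ρ)).sum.totalDegree ≤ e := by
    refine hR.totalDegree_le_of_le_pow (totalDegree_listSum_le ?_)
    simp only [List.forall_mem_map]
    exact fun ψ hψ => hdeg (hR.mem_of_mem_subs hi₀ (mem_subs_mod hψ (mem_subs_self _)))
  refine (((((hR.forced_mod ρ hi).and (hR.forced_mod ρ hi₀)).and (hR.forced_mod ρ hi₁)).and
    (hR.forced_hat_bool (ρ := ρ) (L := L) (hR.depth_le hφ))).and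
    (forced_add (k := 0) hΓ (hR.totalDegree_le_of_le_pow (hdeg hφ)))).mono (by omega) ?_
  rintro B ⟨⟨⟨⟨hi, hi₀⟩, hi₁⟩, hbool⟩, hadd⟩
  have hsum : ((Γ ++ [φ]).map (hat ρ)).sum = (Γ.map (hat ρ)).sum + hat ρ φ := by simp
  rw [hi, hi₀, hi₁, hsum, hadd, Holds]
  rcases hbool with ⟨hφ, -⟩ | ⟨hφ, -⟩ <;> simp [hφ, eq_sub_iff_add_eq]

theorem forced_or_and_neg_and (hor : or [.and [φ, neg χ], .and [ψ, χ]] ∈ R) :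
    ForcedOver F (e := e) (69 * unitCost p h H L d) fun B =>
      Good ρ R B → (Holds ρ B (.or [.and [φ, neg χ], .and [ψ, χ]]) ↔
        Holds ρ B φ ∧ ¬ Holds ρ B χ ∨ Holds ρ B ψ ∧ Holds ρ B χ) := by
  have hcost := hR.le_unitCost
  have hand₁ : Formula.and [φ, neg χ] ∈ R :=
    hR.mem_of_mem_subs hor (mem_subs_or (by simp) (mem_subs_self _))
  have hand₂ : Formula.and [ψ, χ] ∈ R :=
    hR.mem_of_mem_subs hor (mem_subs_or (by simp) (mem_subs_self _))
  have hχ : χ ∈ R :=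
    hR.mem_of_mem_subs hand₂ (by simp [Formula.and, subs, subsAll, mem_subs_self])
  refine ((((hR.forced_or_iff ρ hor).and (hR.forced_and_iff ρ hand₁)).and
    (hR.forced_and_iff ρ hand₂)).and (hR.forced_neg ρ hχ)).mono
    (by simp only [List.length_cons, List.length_nil]; omega) ?_
  rintro B ⟨⟨⟨hor, hand₁⟩, hand₂⟩, hneg⟩ hgood
  simp [hor hgood, hand₁ hgood, hand₂ hgood, hneg]

theorem forced_modAxiom (hφ : IsModAxiom φ) (hφR : φ ∈ R) :
    ForcedOver F (e := e) (138 * unitCost p h H L d) fun B => Good ρ R B → Holds ρ B φ := by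
  have hcost := hR.le_unitCost
  cases hφ with
  | empty_zero =>
    refine ((hR.forced_mod ρ hφR).and (forced_zero (k := 0))).mono (by omega) ?_
    exact fun B ⟨hmod, hzero⟩ _ => hmod.2 (by simpa using hzero)
  | empty_ne i hi =>
    have hmodR : mod i [] ∈ R := hR.mem_of_mem_subs hφR (mem_subs_neg (mem_subs_self _))
    refine (((hR.forced_mod ρ hmodR).and (forced_zero (k := 0))).and
      (hR.forced_neg ρ hmodR)).mono (by omega) ?_
    rintro B ⟨⟨hmod, hzero⟩, hneg⟩ -
    rw [hneg, hmod, List.map_nil, List.sum_nil, hzero]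
    exact hi.symm
  | step i Γ φ =>
    have hsub {ψ} (h : ψ ∈ subs _) : ψ ∈ R := hR.mem_of_mem_subs hφR h
    have hcasesR : or [.and [.mod i Γ, .neg φ], .and [.mod (i - 1) Γ, φ]] ∈ R :=
      hsub (by simp [Formula.iff, Formula.and, subs, subsAll])
    have hmod₀ : mod i Γ ∈ R := hsub (by simp [Formula.iff, Formula.and, subs, subsAll])
    have hmod₁ : mod (i - 1) Γ ∈ R := hsub (by simp [Formula.iff, Formula.and, subs, subsAll])
    have hmod : mod i (Γ ++ [φ]) ∈ R := hsub (by simp [Formula.iff, Formula.and, subs, subsAll])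
    refine (((hR.forced_iff ρ hφR).and (hR.forced_or_and_neg_and (ρ := ρ) hcasesR)).and
      (hR.forced_mod_append (ρ := ρ) hmod hmod₀ hmod₁)).mono (by omega) ?_
    exact fun B ⟨⟨hiff, hcases⟩, happend⟩ hgood =>
      (hiff hgood).2 (happend.trans (hcases hgood).symm)

omit [Fact p.Prime] in
theorem mem_of_mem_ante (hS : S.toFormula ∈ R) (hφ : φ ∈ S.ante) : φ ∈ R :=
  hR.mem_of_mem_subs hS (mem_subs_or (List.mem_append_left _ (List.mem_map_of_mem hφ))
    (mem_subs_neg (mem_subs_self φ)))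

omit [Fact p.Prime] in
theorem mem_of_mem_succ (hS : S.toFormula ∈ R) (hφ : φ ∈ S.succ) : φ ∈ R :=
  hR.mem_of_mem_subs hS (mem_subs_or (List.mem_append_right _ hφ) (mem_subs_self φ))

theorem forced_not_toFormula (hS : S.toFormula ∈ R) (hP : ∀ B, P B → Good ρ R B)
    (hante : ∀ φ ∈ S.ante, ForcedOver F k fun B => P B → Holds ρ B φ)
    (hsucc : ∀ φ ∈ S.succ, ForcedOver F k fun B => P B → ¬ Holds ρ B φ) :
    ForcedOver F (k + 8 * unitCost p h H L d) fun B => P B → ¬ Holds ρ B S.toFormula := by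
  have hcost := hR.le_unitCost
  refine (hR.forced_not_or (k := k + 3 * unitCost p h H L d) hS hP fun χ hχ => ?_).le (by omega)
  rcases List.mem_append.1 hχ with hχ | hχ
  · obtain ⟨φ, hφ, rfl⟩ := List.mem_map.1 hχ
    refine ((hante φ hφ).and (hR.forced_neg ρ (hR.mem_of_mem_ante hS hφ))).mono (by omega) ?_
    exact fun B ⟨hB, hneg⟩ hP => not_not_intro (hB hP) ∘ hneg.1
  · exact (hsucc χ hχ).le (by omega)

theorem forced_of_mem_ante (hS : S.toFormula ∈ R)
    (hP : ∀ B, P B → Good ρ R B ∧ ¬ Holds ρ B S.toFormula) (hφ : φ ∈ S.ante) :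
    ForcedOver F (7 * unitCost p h H L d) fun B => P B → Holds ρ B φ := by
  have hcost := hR.le_unitCost
  refine ((hR.forced_or_of_mem ρ hS (List.mem_append_left _ (List.mem_map_of_mem hφ))).and
    (hR.forced_neg ρ (hR.mem_of_mem_ante hS hφ))).mono (by omega) ?_
  exact fun B ⟨hor, hneg⟩ hPB => by_contra fun hφ => (hP B hPB).2 (hor (hP B hPB).1 (hneg.2 hφ))

theorem forced_not_of_mem_succ (hS : S.toFormula ∈ R)
    (hP : ∀ B, P B → Good ρ R B ∧ ¬ Holds ρ B S.toFormula) (hφ : φ ∈ S.succ) :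
    ForcedOver F (4 * unitCost p h H L d) fun B => P B → ¬ Holds ρ B φ :=
  (hR.forced_or_of_mem ρ hS (List.mem_append_right _ hφ)).imp
    fun B hor hPB hφ => (hP B hPB).2 (hor (hP B hPB).1 hφ)

theorem forced_not_of_premise (hS : S.toFormula ∈ R)
    (hP : ∀ B, P B → Good ρ R B ∧ ¬ Holds ρ B S.toFormula)
    (hS' : S'.toFormula ∈ R ∧ ForcedOver F l fun B => P B → Holds ρ B S'.toFormula)
    (hante : ∀ φ ∈ S'.ante, φ ∈ S.ante ∨ ForcedOver F k fun B => P B → Holds ρ B φ)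
    (hsucc : ∀ φ ∈ S'.succ, φ ∈ S.succ ∨ ForcedOver F k fun B => P B → ¬ Holds ρ B φ) :
    ForcedOver F (k + l + 16 * unitCost p h H L d) fun B => ¬ P B := by
  have hcost := hR.le_unitCost
  refine (hS'.2.not_of_imp_not (hR.forced_not_toFormula (k := k + 7 * unitCost p h H L d) hS'.1
    (fun B hB => (hP B hB).1) (fun φ hφ => ?_) fun φ hφ => ?_)).le (by omega)
  · rcases hante φ hφ with hφ | hφ
    · exact (hR.forced_of_mem_ante hS hP hφ).le (by omega)
    · exact hφ.le (by omega)
  · rcases hsucc φ hφ with hφ | hφ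
    · exact (hR.forced_not_of_mem_succ hS hP hφ).le (by omega)
    · exact hφ.le (by omega)

theorem forced_not_of_premise_cons_ante (hS : S.toFormula ∈ R)
    (hP : ∀ B, P B → Good ρ R B ∧ ¬ Holds ρ B S.toFormula)
    (hante : Γ ⊆ S.ante) (hsucc : Δ ⊆ S.succ)
    (hS' : (Sequent.mk (φ :: Γ) Δ).toFormula ∈ R ∧
      ForcedOver F l fun B => P B → Holds ρ B (Sequent.mk (φ :: Γ) Δ).toFormula)
    (hφ : ForcedOver F k fun B => P B → Holds ρ B φ) :
    ForcedOver F (k + l + 16 * unitCost p h H L d) fun B => ¬ P B := by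
  refine hR.forced_not_of_premise hS hP hS' ?_ fun χ hχ => .inl (hsucc hχ)
  exact List.forall_mem_cons.2 ⟨.inr hφ, fun χ hχ => .inl (hante hχ)⟩

theorem forced_not_of_premise_cons_succ (hS : S.toFormula ∈ R)
    (hP : ∀ B, P B → Good ρ R B ∧ ¬ Holds ρ B S.toFormula)
    (hante : Γ ⊆ S.ante) (hsucc : Δ ⊆ S.succ)
    (hS' : (Sequent.mk Γ (φ :: Δ)).toFormula ∈ R ∧
      ForcedOver F l fun B => P B → Holds ρ B (Sequent.mk Γ (φ :: Δ)).toFormula)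
    (hφ : ForcedOver F k fun B => P B → ¬ Holds ρ B φ) :
    ForcedOver F (k + l + 16 * unitCost p h H L d) fun B => ¬ P B := by
  refine hR.forced_not_of_premise hS hP hS' (fun χ hχ => .inl (hante hχ)) ?_
  exact List.forall_mem_cons.2 ⟨.inr hφ, fun χ hχ => .inl (hsucc hχ)⟩

theorem forced_not_of_cut (hS : S.toFormula ∈ R)
    (hP : ∀ B, P B → Good ρ R B ∧ ¬ Holds ρ B S.toFormula)
    (hl : (Sequent.mk S.ante (φ :: S.succ)).toFormula ∈ R ∧
      ForcedOver F l fun B => P B → Holds ρ B (Sequent.mk S.ante (φ :: S.succ)).toFormula)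
    (hr : (Sequent.mk (φ :: S.ante) S.succ).toFormula ∈ R ∧
      ForcedOver F l fun B => P B → Holds ρ B (Sequent.mk (φ :: S.ante) S.succ).toFormula) :
    ForcedOver F (2 * l + 33 * unitCost p h H L d) fun B => ¬ P B := by
  have hcost := hR.le_unitCost
  have hfalse := hR.forced_not_of_premise_cons_succ (k := 0)
    (P := fun B => P B ∧ ¬ Holds ρ B φ) hS (fun B hB => hP B hB.1) (List.Subset.refl _)
    (List.Subset.refl _) ⟨hl.1, hl.2.imp fun B hB hPB => hB hPB.1⟩ (.of_forall fun B hB => hB.2)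
  have htrue := hR.forced_not_of_premise_cons_ante (k := 0)
    (P := fun B => P B ∧ Holds ρ B φ) hS (fun B hB => hP B hB.1) (List.Subset.refl _)
    (List.Subset.refl _) ⟨hr.1, hr.2.imp fun B hB hPB => hB hPB.1⟩ (.of_forall fun B hB => hB.2)
  exact (hfalse.and htrue).mono (by omega)
    fun B ⟨hfalse, htrue⟩ hPB => hfalse ⟨hPB, fun hφ => htrue ⟨hPB, hφ⟩⟩

theorem forced_not_of_negLeft (hS : (Sequent.mk (φ.neg :: Γ) Δ).toFormula ∈ R)
    (hP : ∀ B, P B → Good ρ R B ∧ ¬ Holds ρ B (Sequent.mk (φ.neg :: Γ) Δ).toFormula)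
    (hS' : (Sequent.mk Γ (φ :: Δ)).toFormula ∈ R ∧
      ForcedOver F l fun B => P B → Holds ρ B (Sequent.mk Γ (φ :: Δ)).toFormula) :
    ForcedOver F (l + 26 * unitCost p h H L d) fun B => ¬ P B := by
  have hcost := hR.le_unitCost
  have hφ : ForcedOver F (9 * unitCost p h H L d + 3) fun B => P B → ¬ Holds ρ B φ :=
    ((hR.forced_of_mem_ante hS hP List.mem_cons_self).and
      (hR.forced_neg ρ (hR.mem_of_mem_succ hS'.1 List.mem_cons_self))).mono (by omega)
      fun B ⟨hB, hneg⟩ hPB => hneg.1 (hB hPB)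
  exact (hR.forced_not_of_premise_cons_succ hS hP (List.subset_cons_self _ _) (List.Subset.refl _)
    hS' hφ).le (by omega)

theorem forced_not_of_negRight (hS : (Sequent.mk Γ (φ.neg :: Δ)).toFormula ∈ R)
    (hP : ∀ B, P B → Good ρ R B ∧ ¬ Holds ρ B (Sequent.mk Γ (φ.neg :: Δ)).toFormula)
    (hS' : (Sequent.mk (φ :: Γ) Δ).toFormula ∈ R ∧
      ForcedOver F l fun B => P B → Holds ρ B (Sequent.mk (φ :: Γ) Δ).toFormula) :
    ForcedOver F (l + 26 * unitCost p h H L d) fun B => ¬ P B := by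
  have hcost := hR.le_unitCost
  have hφ : ForcedOver F (6 * unitCost p h H L d + 3) fun B => P B → Holds ρ B φ :=
    ((hR.forced_not_of_mem_succ hS hP List.mem_cons_self).and
      (hR.forced_neg ρ (hR.mem_of_mem_ante hS'.1 List.mem_cons_self))).mono (by omega)
      fun B ⟨hB, hneg⟩ hPB => by_contra (hB hPB ∘ hneg.2)
  exact (hR.forced_not_of_premise_cons_ante hS hP (List.Subset.refl _) (List.subset_cons_self _ _)
    hS' hφ).le (by omega)

theorem forced_not_of_orLeft (hS : (Sequent.mk (or φs :: Γ) Δ).toFormula ∈ R)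
    (hP : ∀ B, P B → Good ρ R B ∧ ¬ Holds ρ B (Sequent.mk (or φs :: Γ) Δ).toFormula)
    (hS' : ∀ φ ∈ φs, (Sequent.mk (φ :: Γ) Δ).toFormula ∈ R ∧
      ForcedOver F l fun B => P B → Holds ρ B (Sequent.mk (φ :: Γ) Δ).toFormula) :
    ForcedOver F (l + 30 * unitCost p h H L d) fun B => ¬ P B := by
  have hcost := hR.le_unitCost
  have hnot {φ} (hφ : φ ∈ φs) :
      ForcedOver F (l + 16 * unitCost p h H L d) fun B => P B → ¬ Holds ρ B φ :=
    (hR.forced_not_of_premise_cons_ante (k := 0) (P := fun B => P B ∧ Holds ρ B φ) hS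
      (fun B hB => hP B hB.1) (List.subset_cons_self _ _) (List.Subset.refl _)
      ⟨(hS' φ hφ).1, (hS' φ hφ).2.imp fun B hB hPB => hB hPB.1⟩
      (.of_forall fun B hB => hB.2)).mono (by omega) fun B hB hPB hφ => hB ⟨hPB, hφ⟩
  exact ((hR.forced_of_mem_ante hS hP List.mem_cons_self).not_of_imp_not
    (hR.forced_not_or (hR.mem_of_mem_ante hS List.mem_cons_self) (fun B hB => (hP B hB).1)
      fun φ hφ => hnot hφ)).le (by omega)

theorem forced_not_of_orRight (hφ : φ ∈ φs) (hS : (Sequent.mk Γ (or φs :: Δ)).toFormula ∈ R)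
    (hP : ∀ B, P B → Good ρ R B ∧ ¬ Holds ρ B (Sequent.mk Γ (or φs :: Δ)).toFormula)
    (hS' : (Sequent.mk Γ (φ :: Δ)).toFormula ∈ R ∧
      ForcedOver F l fun B => P B → Holds ρ B (Sequent.mk Γ (φ :: Δ)).toFormula) :
    ForcedOver F (l + 25 * unitCost p h H L d) fun B => ¬ P B := by
  have hcost := hR.le_unitCost
  have hφ : ForcedOver F (8 * unitCost p h H L d + 3) fun B => P B → ¬ Holds ρ B φ :=
    ((hR.forced_not_of_mem_succ hS hP List.mem_cons_self).and
      (hR.forced_or_of_mem ρ (hR.mem_of_mem_succ hS List.mem_cons_self) hφ)).mono (by omega)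
      fun B ⟨hB, hor⟩ hPB hφ => hB hPB (hor (hP B hPB).1 hφ)
  exact (hR.forced_not_of_premise_cons_succ hS hP (List.Subset.refl _) (List.subset_cons_self _ _)
    hS' hφ).le (by omega)

theorem forced_not_of_infer {A : Set (Formula p V)} {T : Sequent p V → Prop} (hinf : Infer A T S)
    (hS : S.toFormula ∈ R) (hP : ∀ B, P B → Good ρ R B ∧ ¬ Holds ρ B S.toFormula)
    (hA : ∀ φ ∈ A, φ ∈ R → ForcedOver F k fun B => P B → Holds ρ B φ)
    (hT : ∀ S', T S' → S'.toFormula ∈ R ∧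
      ForcedOver F l fun B => P B → Holds ρ B S'.toFormula) :
    ForcedOver F (k + 2 * l + 150 * unitCost p h H L d) fun B => ¬ P B := by
  have hcost := hR.le_unitCost
  have hstruct {S'} (hS' : T S') (hante : S'.ante ⊆ S.ante) (hsucc : S'.succ ⊆ S.succ) :
      ForcedOver F (k + 2 * l + 150 * unitCost p h H L d) fun B => ¬ P B :=
    (hR.forced_not_of_premise (k := 0) hS hP (hT S' hS') (fun φ hφ => .inl (hante hφ))
      fun φ hφ => .inl (hsucc hφ)).le (by omega)
  cases hinf with
  | init φ =>
    exact ((hR.forced_of_mem_ante hS hP List.mem_cons_self).not_of_imp_not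
      (hR.forced_not_of_mem_succ hS hP List.mem_cons_self)).le (by omega)
  | modAxiom φ hφ =>
    exact (((hR.forced_modAxiom hφ (hR.mem_of_mem_succ hS List.mem_cons_self)).imp
      fun B hB hPB => hB (hP B hPB).1).not_of_imp_not
      (hR.forced_not_of_mem_succ hS hP List.mem_cons_self)).le (by omega)
  | nonlogical φ hφ =>
    exact ((hA φ hφ (hR.mem_of_mem_succ hS List.mem_cons_self)).not_of_imp_not
      (hR.forced_not_of_mem_succ hS hP List.mem_cons_self)).le (by omega)
  | weakLeft φ Γ Δ hS' => exact hstruct hS' (List.subset_cons_self _ _) (List.Subset.refl _)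
  | weakRight φ Γ Δ hS' => exact hstruct hS' (List.Subset.refl _) (List.subset_cons_self _ _)
  | contrLeft φ Γ Δ hS' => exact hstruct hS' (by simp) (List.Subset.refl _)
  | contrRight φ Γ Δ hS' => exact hstruct hS' (List.Subset.refl _) (by simp)
  | exchange Γ Γ' Δ Δ' hΓ hΔ hS' => exact hstruct hS' hΓ.subset hΔ.subset
  | cut φ Γ Δ hl hr => exact (hR.forced_not_of_cut hS hP (hT _ hl) (hT _ hr)).le (by omega)
  | negLeft φ Γ Δ hS' => exact (hR.forced_not_of_negLeft hS hP (hT _ hS')).le (by omega)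
  | negRight φ Γ Δ hS' => exact (hR.forced_not_of_negRight hS hP (hT _ hS')).le (by omega)
  | orLeft φs Γ Δ hS' =>
    exact (hR.forced_not_of_orLeft hS hP fun φ hφ => hT _ (hS' φ hφ)).le (by omega)
  | orRight φs φ Γ Δ hφ hS' => exact (hR.forced_not_of_orRight hφ hS hP (hT _ hS')).le (by omega)

end Admissible

end Rules

section Equations

open MvPolynomial Formula

variable {p : ℕ} {V : Type u}

theorem val_monomial {e : ℕ} (B : LowDeg p V e → ZMod p) {m : V →₀ ℕ} (hm : m.degree ≤ e) :
    val B (monomial m 1) = val B (∏ x ∈ m.support, X x) := by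
  classical
  set m' : V →₀ ℕ := ∑ x ∈ m.support, Finsupp.single x 1 with hm'
  have hsupport : m'.support = m.support := by
    ext i
    rw [Finsupp.mem_support_iff, hm', Finsupp.finsetSum_apply]
    simp [Finsupp.single_apply]
  have hdegree : m'.degree ≤ e := by
    simpa [hm'] using (card_support_le_degree m).trans hm
  have hprod : ∏ x ∈ m.support, X x = monomial m' (1 : ZMod p) :=
    (monomial_sum_one m.support fun i => Finsupp.single i 1).symm
  have htoLow : toLow e (monomial m (1 : ZMod p)) = toLow e (monomial m' 1) :=
    Subtype.ext (by rw [coe_toLow_monomial hm, coe_toLow_monomial hdegree, hsupport])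
  rw [val, val, hprod, htoLow]

/-- The conjunction of the variables of a monomial. -/
noncomputable def monomialFormula (p : ℕ) (m : V →₀ ℕ) : Formula p V :=
  .and (m.support.toList.map .var)

variable [Fact p.Prime] [Fintype V] {F : Finset (MvPolynomial V (ZMod p))}
  {h H L d e D : ℕ} {ρ : Formula p V → Fin h → Formula p V → ZMod p} {R : Finset (Formula p V)}
  {f : MvPolynomial V (ZMod p)}

namespace Admissible

variable (hR : Admissible R h H L d e)

include hR

theorem mulCost_le_unitCost : mulCost p H ((h * p) ^ (d + 1)) ≤ unitCost p h H L d := by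
  have hcost := hR.toBudget.le_unitCost (L := L)
  have hp := Nat.le_mul_of_pos_left (mulCost p H ((h * p) ^ (d + 1))) (Fact.out : p.Prime).pos
  omega

variable (ρ) in
theorem forced_monomialFormula {m : V →₀ ℕ} (hm : monomialFormula p m ∈ R) (hmD : m.degree ≤ D)
    (hD : D ≤ (h * p) ^ (d + 1)) :
    ForcedOver F (e := e) ((10 * D + 13) * unitCost p h H L d) fun B =>
      Good ρ R B → val B (hat ρ (monomialFormula p m)) = val B (monomial m 1) := by
  have hcost := hR.le_unitCost
  have hmul := hR.mulCost_le_unitCost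
  have hdeg := hR.degree_le
  have hcard : m.support.card ≤ D := (card_support_le_degree m).trans hmD
  have hprod := forced_prod (F := F) hR.card_le hR.degree_le (N := 1) (G := fun x => X x) m.support
    (fun x _ => (totalDegree_X (R := ZMod p) x).le) (by omega)
  have hvars := Forced.forall_mem m.support fun x _ => forced_X (F := F) (e := e) (k := 0)
    (by have := Nat.one_le_pow (d + 1) _ hR.hp_pos; omega) x
  refine ((((hR.forced_and_iff ρ hm).and hprod).and hvars).and
    (hR.forced_hat_bool (ρ := ρ) (L := L) (hR.depth_le hm))).mono ?_ ?_
  · have h₁ := Nat.mul_le_mul hcard hmul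
    have h₂ : m.support.card * (0 + 3) ≤ D * unitCost p h H L d := Nat.mul_le_mul hcard (by omega)
    have h₃ : (8 * (m.support.toList.map (Formula.var (p := p))).length + 9) * unitCost p h H L d ≤
        (8 * D + 9) * unitCost p h H L d := by
      refine Nat.mul_le_mul_right _ ?_
      rw [List.length_map, Finset.length_toList]
      omega
    linarith
  · rintro B ⟨⟨⟨hand, hprod⟩, hvars⟩, hbool⟩ hgood
    rw [val_monomial B (by omega), hprod]
    specialize hand hgood
    simp only [List.forall_mem_map, Finset.mem_toList, Holds, hat_var] at hand
    rcases hbool with ⟨hfalse, -⟩ | ⟨htrue, -⟩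
    · obtain ⟨x, hx, hzero⟩ : ∃ x ∈ m.support, val B (X x) = 0 := by
        by_contra! hne
        exact hand.2 hne hfalse
      exact hfalse.trans (Finset.prod_eq_zero hx hzero).symm
    · refine htrue.trans (Finset.prod_eq_one fun x hx => (hvars x hx).resolve_left ?_).symm
      exact hand.1 (by rw [monomialFormula] at htrue; simp [htrue]) x hx

theorem forced_C_mul_monomialFormula_sub {m : V →₀ ℕ} (hm : monomialFormula p m ∈ R)
    (hmD : m.degree ≤ D) (hD : D ≤ (h * p) ^ (d + 1)) (c : ZMod p) :
    ForcedOver F (e := e) ((10 * D + 16) * unitCost p h H L d) fun B =>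
      Good ρ R B → val B (C c * (hat ρ (monomialFormula p m) - monomial m 1)) = 0 := by
  have hcost := hR.le_unitCost
  have hψe : (hat ρ (monomialFormula p m)).totalDegree ≤ e :=
    hR.totalDegree_le_of_le_pow (hR.totalDegree_hat_le (hR.depth_le hm))
  have hme : (monomial m (1 : ZMod p)).totalDegree ≤ e :=
    hR.totalDegree_le ((totalDegree_monomial_le_degree m 1).trans (hmD.trans hD))
  have hsub := (hR.forced_monomialFormula (F := F) ρ hm hmD hD).and <|
    (forced_sub (F := F) hψe hme).and <|
      forced_C_mul (F := F) ((totalDegree_sub _ _).trans (max_le hψe hme)) c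
  refine hsub.mono (by linarith) fun B ⟨hmono, hsub, hmul⟩ hgood => ?_
  rw [hmul, hsub, hmono hgood, sub_self, mul_zero]

theorem forced_eqFormula_iff (hf : eqFormula f ∈ R) :
    ForcedOver F (e := e) (unitCost p h H L d) fun B => Holds ρ B (eqFormula f) ↔
      val B (∑ m ∈ f.support, C (f.coeff m) * hat ρ (monomialFormula p m)) = 0 := by
  have hsum (s : List (V →₀ ℕ)) : ((s.flatMap fun m => List.replicate (f.coeff m).val
      (monomialFormula p m)).map (hat ρ)).sum =
        (s.map fun m => C (f.coeff m) * hat ρ (monomialFormula p m)).sum := by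
    induction s with
    | nil => rfl
    | cons m s ih =>
      rw [List.flatMap_cons, List.map_append, List.sum_append, ih, List.map_cons, List.sum_cons,
        List.map_replicate, List.sum_replicate, nsmul_eq_mul,
        ← map_natCast (C (σ := V) (R := ZMod p)), ZMod.natCast_zmod_val]
  refine (hR.forced_mod ρ hf).imp fun B hB => ?_
  rw [← Finset.sum_map_toList, ← hsum]
  exact hB

theorem monomialFormula_mem (hf : eqFormula f ∈ R) {m : V →₀ ℕ} (hm : m ∈ f.support) :
    monomialFormula p m ∈ R := by
  refine hR.mem_of_mem_subs hf (mem_subs_mod (List.mem_flatMap.2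
    ⟨m, Finset.mem_toList.2 hm, List.mem_replicate.2 ⟨fun h => ?_, rfl⟩⟩) (mem_subs_self _))
  exact mem_support_iff.1 hm ((ZMod.val_eq_zero _).1 h)

theorem forced_eqFormula (hf : f ∈ F) (hfR : eqFormula f ∈ R) (hfD : f.totalDegree ≤ D)
    (hD : D ≤ (h * p) ^ (d + 1)) :
    ForcedOver F (e := e) ((10 * D + 20) * unitCost p h H L d) fun B =>
      Good ρ R B → Holds ρ B (eqFormula f) := by
  have hcost := hR.le_unitCost
  have hmul := hR.mulCost_le_unitCost
  have hψ {m} (hm : m ∈ f.support) : monomialFormula p m ∈ R := hR.monomialFormula_mem hfR hm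
  set ψ : (V →₀ ℕ) → MvPolynomial V (ZMod p) := fun m => hat ρ (monomialFormula p m)
  have hψe {m} (hm : m ∈ f.support) : (ψ m).totalDegree ≤ e :=
    hR.totalDegree_le_of_le_pow (hR.totalDegree_hat_le (hR.depth_le (hψ hm)))
  have hmD {m} (hm : m ∈ f.support) : m.degree ≤ D := (le_totalDegree hm).trans hfD
  have hfe : f.totalDegree ≤ e := hR.totalDegree_le (hfD.trans hD)
  have hsum : ForcedOver F (e := e) ((10 * D + 18) * unitCost p h H L d)
      fun B => Good ρ R B → val B (∑ m ∈ f.support, C (f.coeff m) * (ψ m - monomial m 1)) = 0 := by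
    rw [mulCost] at hmul
    refine (forced_sum_eq_zero (card_support_le hR.card_le (hfD.trans hD))
      (fun m hm => (totalDegree_mul _ _).trans ?_) fun m hm =>
        hR.forced_C_mul_monomialFormula_sub (hψ hm) (hmD hm) hD (f.coeff m)).le (by linarith)
    simpa using (totalDegree_sub _ _).trans (max_le (hψe hm)
      (hR.totalDegree_le ((totalDegree_monomial_le_degree m 1).trans ((hmD hm).trans hD))))
  have hsplit : ∑ m ∈ f.support, C (f.coeff m) * (ψ m - monomial m 1) =
      ∑ m ∈ f.support, C (f.coeff m) * ψ m - f := by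
    simp only [mul_sub, Finset.sum_sub_distrib, C_mul_monomial, mul_one,
      support_sum_monomial_coeff]
  have hge : (∑ m ∈ f.support, C (f.coeff m) * ψ m).totalDegree ≤ e :=
    totalDegree_finsetSum_le fun m hm => (totalDegree_mul _ _).trans (by simpa using hψe hm)
  rw [hsplit] at hsum
  refine (((hsum.and (forced_sub hge hfe)).and (forced_eqn (k := 0) hf hfe)).and
    (hR.forced_eqFormula_iff (ρ := ρ) hfR)).mono (by linarith) ?_
  rintro B ⟨⟨⟨hsum, hsub⟩, hfzero⟩, hiff⟩ hgood
  exact hiff.2 (by simpa only [hsum hgood, hfzero, sub_zero] using hsub.symm)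

end Admissible

end Equations

section Refutations

open Formula

variable {p : ℕ} {V : Type u}

/-- The formula saying that one of the first `i` sequents of `π` is false. -/
def prefixFormula (π : List (Sequent p V)) (i : ℕ) : Formula p V :=
  .or ((π.take i).map fun S => .neg S.toFormula)

variable [Fact p.Prime] [Fintype V] {F : Finset (MvPolynomial V (ZMod p))}
  {h H L d e i k : ℕ} {ρ : Formula p V → Fin h → Formula p V → ZMod p} {R : Finset (Formula p V)}
  {d₀ : ℕ} {A : Set (Formula p V)} {π : List (Sequent p V)} {S : Sequent p V}

namespace Admissible

variable (hR : Admissible R h H L d e)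

include hR

omit [Fact p.Prime] in
theorem toFormula_mem (hi : prefixFormula π i ∈ R) (hS : S ∈ π.take i) : S.toFormula ∈ R :=
  hR.mem_of_mem_subs hi
    (mem_subs_or (List.mem_map_of_mem hS) (mem_subs_neg (mem_subs_self _)))

variable (ρ) in
theorem forced_toFormula_of_mem_take (hi : prefixFormula π i ∈ R) (hS : S ∈ π.take i) :
    ForcedOver F (e := e) (7 * unitCost p h H L d) fun B =>
      Good ρ R B ∧ ¬ Holds ρ B (prefixFormula π i) → Holds ρ B S.toFormula := by
  have hcost := hR.le_unitCost
  refine ((hR.forced_or_of_mem ρ hi (List.mem_map_of_mem hS)).and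
    (hR.forced_neg ρ (hR.toFormula_mem hi hS))).mono (by omega) ?_
  exact fun B ⟨hor, hneg⟩ hB => by_contra fun hS => hB.2 (hor hB.1 (hneg.2 hS))

theorem forced_toFormula_getElem (hinfer : Infer A (fun S => S ∈ π.take i) S)
    (hi : prefixFormula π i ∈ R) (hS : S.toFormula ∈ R)
    (hA : ∀ φ ∈ A, φ ∈ R → ForcedOver F (e := e) k fun B => Good ρ R B → Holds ρ B φ) :
    ForcedOver F (e := e) (k + 165 * unitCost p h H L d) fun B =>
      Good ρ R B ∧ ¬ Holds ρ B (prefixFormula π i) → Holds ρ B S.toFormula := by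
  refine (hR.forced_not_of_infer (F := F) (l := 7 * unitCost p h H L d)
    (P := fun B => (Good ρ R B ∧ ¬ Holds ρ B (prefixFormula π i)) ∧ ¬ Holds ρ B S.toFormula)
    hinfer hS (fun B hB => ⟨hB.1.1, hB.2⟩)
    (fun φ hφ hφR => (hA φ hφ hφR).imp fun B hB hP => hB hP.1.1)
    fun S' hS' => ⟨hR.toFormula_mem hi hS', (hR.forced_toFormula_of_mem_take ρ hi hS').imp
      fun B hB hP => hB hP.1⟩).mono (by omega) ?_
  exact fun B hB hP => by_contra fun hS => hB ⟨hP, hS⟩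

theorem forced_prefixFormula_succ (hπ : IsRefutation d₀ A π) (hi : i < π.length)
    (hiR : prefixFormula π i ∈ R) (hiR' : prefixFormula π (i + 1) ∈ R)
    (hA : ∀ φ ∈ A, φ ∈ R → ForcedOver F (e := e) k fun B => Good ρ R B → Holds ρ B φ) :
    ForcedOver F (e := e) (k + 173 * unitCost p h H L d) fun B =>
      Good ρ R B → ¬ Holds ρ B (prefixFormula π i) → ¬ Holds ρ B (prefixFormula π (i + 1)) := by
  have hcost := hR.le_unitCost
  refine (hR.forced_not_or (k := k + 168 * unitCost p h H L d) (ρ := ρ)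
    (P := fun B => Good ρ R B ∧ ¬ Holds ρ B (prefixFormula π i)) hiR' (fun B hB => hB.1)
    fun φ hφ => ?_).mono (by omega) fun B hB hgood hi => hB ⟨hgood, hi⟩
  obtain ⟨S, hS, rfl⟩ := List.mem_map.1 hφ
  have hSR : S.toFormula ∈ R := hR.toFormula_mem hiR' hS
  have htrue : ForcedOver F (e := e) (k + 165 * unitCost p h H L d) fun B =>
      Good ρ R B ∧ ¬ Holds ρ B (prefixFormula π i) → Holds ρ B S.toFormula := by
    rw [List.take_succ_eq_append_getElem hi, List.mem_append, List.mem_singleton] at hS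
    obtain hS | rfl := hS
    · exact (hR.forced_toFormula_of_mem_take ρ hiR hS).le (by omega)
    · exact hR.forced_toFormula_getElem (hπ.infer i hi) hiR hSR hA
  exact (htrue.and (hR.forced_neg ρ hSR)).mono (by omega)
    fun B ⟨htrue, hneg⟩ hP hnot => hneg.1 hnot (htrue hP)

theorem forced_not_good (hπ : IsRefutation d₀ A π) (hlen : π.length ≤ 2 ^ L)
    (hπR : ∀ i ≤ π.length, prefixFormula π i ∈ R)
    (hA : ∀ φ ∈ A, φ ∈ R → ForcedOver F (e := e) k fun B => Good ρ R B → Holds ρ B φ) :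
    ForcedOver F (e := e) (k + 192 * unitCost p h H L d) fun B => ¬ Good ρ R B := by
  have hcost := hR.le_unitCost
  have hsearch := Forced.binary_search (P := Good ρ R)
    (Ψ := fun i B => ¬ Holds ρ B (prefixFormula π i))
    (fun i => decidedBy_val (hat ρ (prefixFormula π i)) fun x => ¬ x ≠ 0)
    (Nat.zero_le π.length) (by simpa using hlen) fun i _ hi =>
      hR.forced_prefixFormula_succ hπ hi (hπR i hi.le) (hπR (i + 1) hi) hA
  have hfalse (hor : Formula.or [] ∈ R) : ForcedOver F (e := e) (5 * unitCost p h H L d)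
      fun B => Good ρ R B → ¬ Holds ρ B (.or []) := by
    simpa using hR.forced_not_or (F := F) (k := 0) (P := Good ρ R) hor (fun _ => id) (by simp)
  have hlast : (⟨[], []⟩ : Sequent p V) ∈ π.take π.length := by
    rw [List.take_length]
    exact List.mem_of_getLast? hπ.last
  refine (((hsearch.and (hfalse (hπR 0 (Nat.zero_le _)))).and
    (hR.forced_toFormula_of_mem_take ρ (hπR _ le_rfl) hlast)).and
    (hfalse (hR.toFormula_mem (hπR _ le_rfl) hlast))).mono (by omega) ?_
  rintro B ⟨⟨⟨hsearch, hzero⟩, hmem⟩, hempty⟩ hgood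
  exact hempty hgood (hmem ⟨hgood, hsearch hgood (hzero hgood)⟩)

end Admissible

end Refutations

/-! ### Random coefficients -/

section Averaging

theorem exists_mul_card_filter_le {α β : Type*} [Fintype β] [Nonempty β] {s : Finset α} {n : ℕ}
    {r : α → β → Prop} [∀ a b, Decidable (r a b)]
    (hr : ∀ a ∈ s, n * (Finset.univ.filter (r a)).card ≤ Fintype.card β) :
    ∃ b, n * (s.filter fun a => r a b).card ≤ s.card := by
  have hcount : ∑ a ∈ s, (Finset.univ.filter (r a)).card = ∑ b, (s.filter fun a => r a b).card :=
    Finset.sum_card_bipartiteAbove_eq_sum_card_bipartiteBelow r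
  have hsum : ∑ b, n * (s.filter fun a => r a b).card ≤ ∑ _b : β, s.card := by
    rw [← Finset.mul_sum, ← hcount, Finset.mul_sum, Finset.sum_const, Finset.card_univ,
      smul_eq_mul, mul_comm (Fintype.card β)]
    exact Finset.sum_le_card_nsmul _ _ _ hr
  obtain ⟨b, -, hb⟩ := Finset.exists_le_of_sum_le Finset.univ_nonempty hsum
  exact ⟨b, hb⟩

open scoped Classical in
theorem card_filter_mul_card_le {G W : Type*} [Fintype G] [Fintype W] [AddGroup W] (f : G → W)
    {q : W → Prop} (hq : ∀ w c c', q (w + f c) → q (w + f c') → c = c') :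
    (Finset.univ.filter q).card * Fintype.card G ≤ Fintype.card W := by
  rw [← Finset.card_univ (α := G), ← Finset.card_product, ← Finset.card_univ]
  refine Finset.card_le_card_of_injOn (fun x => x.1 - f x.2) (fun _ _ => Finset.mem_univ _) ?_
  rintro ⟨w, c⟩ hw ⟨w', c'⟩ hw' (hww' : w - f c = w' - f c')
  have hqw {w c} (hw : (w, c) ∈ ((Finset.univ.filter q ×ˢ Finset.univ : Finset (W × G)) :
      Set (W × G))) : q (w - f c + f c) := by simpa using hw
  obtain rfl := hq (w - f c) c c' (hqw hw) (hww' ▸ hqw hw')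
  rw [sub_left_inj.1 hww']

end Averaging

section Coefficients

open MvPolynomial Formula

variable {p h e : ℕ} {V : Type u} {R : Finset (Formula p V)} {a : Formula p V}
  {φs : List (Formula p V)} {ρ : Formula p V → Fin h → Formula p V → ZMod p}

open scoped Classical in
/-- Coefficients at the formulas in `R`, extended by zero. -/
noncomputable def extendCoeffs (w : R → Fin h → R → ZMod p) :
    Formula p V → Fin h → Formula p V → ZMod p :=
  fun φ i a => if hR : φ ∈ R ∧ a ∈ R then w ⟨φ, hR.1⟩ i ⟨a, hR.2⟩ else 0

open scoped Classical in
/-- The translation that adds `c i` to the coefficient of `a` in the `i`-th linear combination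
for `φ`. -/
noncomputable def shift {ι : Type*} (φ a : ι) (c : Fin h → ZMod p) : ι → Fin h → ι → ZMod p :=
  Pi.single φ fun i => Pi.single a (c i)

theorem extendCoeffs_add_shift (w : R → Fin h → R → ZMod p) (φ a : R) (c : Fin h → ZMod p) :
    extendCoeffs (w + shift φ a c) = extendCoeffs w + shift φ.1 a.1 c := by
  classical
  funext ψ i b
  by_cases hψ : ψ = φ <;> by_cases hb : b = a <;>
    simp +contextual [extendCoeffs, shift, Subtype.ext_iff, hψ, hb]

theorem hat_add_shift (ha : a ∈ disjuncts φs) (c : Fin h → ZMod p) (b : Formula p V) :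
    hat (ρ + shift (.or φs) b c) a = hat ρ a := by
  refine hat_congr fun ψ hψ => ?_
  have hne : ψ ≠ .or φs := by
    rintro rfl
    exact absurd (size_lt_of_mem_disjuncts ha) (size_le_of_mem_subs hψ).not_gt
  simp [shift, hne]

theorem comb_add_shift (ha : a ∈ disjuncts φs) (c : Fin h → ZMod p) (i : Fin h) :
    comb (ρ + shift (.or φs) a c) φs i = comb ρ φs i + C (c i) * hat ρ a := by
  classical
  have hterm {b} (hb : b ∈ disjuncts φs) : C ((ρ + shift (.or φs) a c) (.or φs) i b) *
      hat (ρ + shift (.or φs) a c) b =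
        C (ρ (.or φs) i b) * hat ρ b + if b = a then C (c i) * hat ρ a else 0 := by
    rw [hat_add_shift hb]
    split_ifs with hba <;> simp [shift, hba, add_mul]
  rw [comb, Finset.sum_congr rfl fun b => hterm, Finset.sum_add_distrib,
    Finset.sum_ite_eq' _ a, if_pos ha, comb]

variable [Fact p.Prime]

theorem eq_of_hides_add_shift {B : LowDeg p V e → ZMod p} (ha : a ∈ disjuncts φs)
    {c c' : Fin h → ZMod p} (hc : Hides (ρ + shift (.or φs) a c) B φs a)
    (hc' : Hides (ρ + shift (.or φs) a c') B φs a) : c = c' := by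
  simp only [Hides, Holds, comb_add_shift ha, hat_add_shift ha, add_assoc, ← add_mul, ← C_add]
    at hc hc'
  funext i
  have hline := hc.2 i (c' i - c i)
  have hzero := hc'.2 i 0
  rw [add_sub_cancel] at hline
  rw [add_zero, hline, zero_mul, mul_eq_zero, or_iff_left hc.1, sub_eq_zero] at hzero
  exact hzero.symm

open scoped Classical in
theorem card_hides_mul_le (B : LowDeg p V e → ZMod p) (φ a : R) :
    (Finset.univ.filter fun w : R → Fin h → R → ZMod p => ∃ φs, φ.1 = .or φs ∧
      a.1 ∈ disjuncts φs ∧ Hides (extendCoeffs w) B φs a).card * p ^ h ≤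
        Fintype.card (R → Fin h → R → ZMod p) := by
  have hcard : p ^ h = Fintype.card (Fin h → ZMod p) := by simp [ZMod.card]
  rw [hcard]
  refine card_filter_mul_card_le (shift φ a) ?_
  rintro w c c' ⟨φs, hφ, ha, hc⟩ ⟨φs', hφ', -, hc'⟩
  obtain rfl : φs = φs' := Formula.or.inj (hφ.symm.trans hφ')
  rw [extendCoeffs_add_shift, hφ] at hc hc'
  exact eq_of_hides_add_shift ha hc hc'

open scoped Classical in
theorem card_not_good_mul_le (hR : ∀ φs, .or φs ∈ R → disjuncts φs ⊆ R)
    (B : LowDeg p V e → ZMod p) :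
    (Finset.univ.filter fun w : R → Fin h → R → ZMod p =>
      ¬ Good (extendCoeffs w) R B).card * p ^ h ≤
        R.card ^ 2 * Fintype.card (R → Fin h → R → ZMod p) := by
  have hcover : (Finset.univ.filter fun w : R → Fin h → R → ZMod p =>
      ¬ Good (extendCoeffs w) R B) ⊆ Finset.univ.biUnion fun x : R × R =>
        Finset.univ.filter fun w => ∃ φs, x.1.1 = .or φs ∧ x.2.1 ∈ disjuncts φs ∧
          Hides (extendCoeffs w) B φs x.2 := fun w hw => by
    simp only [Finset.mem_filter_univ, Good, not_forall, not_not] at hw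
    obtain ⟨φs, hφs, a, ha, hhides⟩ := hw
    simp only [Finset.mem_biUnion, Finset.mem_filter_univ]
    exact ⟨(⟨.or φs, hφs⟩, ⟨a, hR φs hφs ha⟩), Finset.mem_univ _, φs, rfl, ha, hhides⟩
  refine (Nat.mul_le_mul_right _ ((Finset.card_le_card hcover).trans
    Finset.card_biUnion_le)).trans ?_
  rw [Finset.sum_mul]
  refine (Finset.sum_le_card_nsmul _ _ _ fun x _ => card_hides_mul_le B x.1 x.2).trans_eq ?_
  simp [sq]

open scoped Classical in
theorem exists_card_not_good_le (hR : ∀ φs, .or φs ∈ R → disjuncts φs ⊆ R)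
    (hcard : 2 * R.card ^ 2 ≤ p ^ h) (Ω : Finset (LowDeg p V e → ZMod p)) :
    ∃ ρ : Formula p V → Fin h → Formula p V → ZMod p,
      2 * (Ω.filter fun B => ¬ Good ρ R B).card ≤ Ω.card := by
  have hpos : 0 < p ^ h := pow_pos (Fact.out : p.Prime).pos h
  have hbound (B : LowDeg p V e → ZMod p) : 2 * (Finset.univ.filter fun
      w : R → Fin h → R → ZMod p => ¬ Good (extendCoeffs w) R B).card ≤
        Fintype.card (R → Fin h → R → ZMod p) :=
    Nat.le_of_mul_le_mul_right (calc
      _ = 2 * (Finset.card _ * p ^ h) := by ring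
      _ ≤ 2 * (R.card ^ 2 * _) := Nat.mul_le_mul_left 2 (card_not_good_mul_le hR B)
      _ = 2 * R.card ^ 2 * _ := by ring
      _ ≤ p ^ h * _ := Nat.mul_le_mul_right _ hcard
      _ = _ := mul_comm _ _) hpos
  obtain ⟨w, hw⟩ := exists_mul_card_filter_le (s := Ω) fun B _ => hbound B
  exact ⟨extendCoeffs w, hw⟩

end Coefficients

section Probability

variable {p e : ℕ} {V : Type u} {F : Finset (MvPolynomial V (ZMod p))}

theorem exists_probNoError_le_half {k : ℕ} {P : (LowDeg p V e → ZMod p) → Prop} [DecidablePred P]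
    (hP : ForcedOver F k P) {Ω : Finset (LowDeg p V e → ZMod p)}
    (hΩ : 2 * (Ω.filter P).card ≤ Ω.card) :
    ∃ T : SearchTree p (LowDeg p V e) (ErrorLabel p F e),
      T.DepthLE k ∧ probNoError Ω T ≤ 1 / 2 := by
  classical
  obtain ⟨T, hdepth, hT⟩ := hP
  refine ⟨T, hdepth, div_le_of_le_mul₀ (Nat.cast_nonneg _) (by norm_num) ?_⟩
  have hle : (Ω.filter fun B => ¬ (T.eval B).IsError B).card ≤ (Ω.filter P).card :=
    Finset.card_le_card <| Finset.monotone_filter_right _ fun B _ hB =>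
      by_contra fun hP => hB (hT B hP)
  have : (2 * (Ω.filter fun B => ¬ (T.eval B).IsError B).card : ℝ) ≤ Ω.card := by
    exact_mod_cast (Nat.mul_le_mul_left 2 hle).trans hΩ
  linarith

end Probability

/-! ### Formulas occurring in a refutation -/

section Sizes

open Formula

variable {p d : ℕ} {V : Type u} {φ : Formula p V} {φs : List (Formula p V)}
  {π : List (Sequent p V)}

namespace Formula

theorem depthUnderOr_le {k : ℕ} (h : ∀ φ ∈ φs, φ.depth < k) : depthUnderOr φs ≤ k := by
  induction φs with
  | nil => exact Nat.zero_le k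
  | cons φ φs ih =>
    rw [List.forall_mem_cons] at h
    rw [depthUnderOr]
    exact max_le (by split_ifs <;> omega) (ih h.2)

theorem depth_or_le {k : ℕ} (hk : 1 ≤ k) (h : ∀ φ ∈ φs, φ.depth < k) : (or φs).depth ≤ k := by
  rw [depth]
  exact max_le hk (depthUnderOr_le h)

theorem depth_neg_le (φ : Formula p V) : (neg φ).depth ≤ φ.depth + 1 := by
  rw [depth]; split <;> omega

theorem one_le_size (φ : Formula p V) : 1 ≤ φ.size := by
  cases φ <;> simp [size]

theorem sizeSum_eq_sum (φs : List (Formula p V)) : sizeSum φs = (φs.map size).sum := by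
  induction φs with
  | nil => rfl
  | cons φ φs ih => rw [sizeSum, List.map_cons, List.sum_cons, ih]

theorem sizeSum_append (φs ψs : List (Formula p V)) :
    sizeSum (φs ++ ψs) = sizeSum φs + sizeSum ψs := by
  simp only [sizeSum_eq_sum, List.map_append, List.sum_append]

theorem sizeSum_map_neg_le (φs : List (Formula p V)) :
    sizeSum (φs.map neg) ≤ 2 * sizeSum φs := by
  rw [sizeSum_eq_sum, sizeSum_eq_sum, ← List.sum_map_mul_left, List.map_map]
  refine List.sum_le_sum fun φ _ => ?_
  have := φ.one_le_size
  simp only [Function.comp_apply, size]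
  omega

end Formula

theorem size_neg_toFormula_le (S : Sequent p V) :
    (neg S.toFormula).size ≤ 2 * (1 + sizeSum S.ante + sizeSum S.succ) := by
  have := sizeSum_map_neg_le S.ante
  rw [Sequent.toFormula, size, size, sizeSum_append]
  omega

theorem size_prefixFormula_le (π : List (Sequent p V)) (i : ℕ) :
    (prefixFormula π i).size ≤ 2 * proofSize π + 1 := by
  rw [prefixFormula, size, sizeSum_eq_sum, List.map_map, proofSize, ← List.sum_map_mul_left]
  refine Nat.add_le_add_right ((List.sum_le_sum fun S _ => size_neg_toFormula_le S).trans ?_) 1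
  exact ((List.take_sublist i π).map _).sum_le_sum fun _ _ => Nat.zero_le _

theorem length_le_proofSize (π : List (Sequent p V)) : π.length ≤ proofSize π := by
  rw [← List.length_map, proofSize]
  exact List.length_le_sum_of_one_le _ (by simp [add_assoc])

theorem depth_toFormula_le {S : Sequent p V} (hS : ∀ φ ∈ S.ante ++ S.succ, φ.depth ≤ d) :
    S.toFormula.depth ≤ d + 2 := by
  refine depth_or_le (by omega) fun ψ hψ => ?_
  simp only [List.mem_append, List.mem_map] at hS hψ
  rcases hψ with ⟨φ, hφ, rfl⟩ | hψ
  · have hneg := depth_neg_le φ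
    have hle := hS φ (.inl hφ)
    omega
  · have hle := hS ψ (.inr hψ)
    omega

theorem depth_prefixFormula_le (hd : ∀ S ∈ π, ∀ φ ∈ S.ante ++ S.succ, φ.depth ≤ d) (i : ℕ) :
    (prefixFormula π i).depth ≤ d + 4 := by
  refine depth_or_le (by omega) fun χ hχ => ?_
  obtain ⟨S, hS, rfl⟩ := List.mem_map.1 hχ
  have hle := depth_toFormula_le (hd S (List.mem_of_mem_take hS))
  have hneg := depth_neg_le S.toFormula
  omega

open scoped Classical in
/-- The subformulas of the formulas saying that one of the first sequents of `π` is false. -/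
noncomputable def relevantFormulas (π : List (Sequent p V)) : Finset (Formula p V) :=
  ((List.range (π.length + 1)).flatMap fun i => subs (prefixFormula π i)).toFinset

theorem mem_relevantFormulas :
    φ ∈ relevantFormulas π ↔ ∃ i ≤ π.length, φ ∈ subs (prefixFormula π i) := by
  simp [relevantFormulas]

theorem card_relevantFormulas_le (π : List (Sequent p V)) :
    (relevantFormulas π).card ≤ (π.length + 1) * (2 * proofSize π + 1) := by
  classical
  refine (List.toFinset_card_le _).trans ?_
  rw [List.length_flatMap]
  refine (List.sum_le_card_nsmul _ (2 * proofSize π + 1) fun n hn => ?_).trans (by simp)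
  obtain ⟨i, -, rfl⟩ := List.mem_map.1 hn
  exact (length_subs _).trans_le (size_prefixFormula_le π i)

theorem admissible_relevantFormulas [Fintype V] {h H L e : ℕ} (hb : Budget p V h H (d + 4) e)
    (hd : ∀ S ∈ π, ∀ φ ∈ S.ante ++ S.succ, φ.depth ≤ d)
    (hL : (relevantFormulas π).card ≤ 2 ^ L) :
    Admissible (relevantFormulas π) h H L (d + 4) e where
  toBudget := hb
  mem_of_mem_subs hφ hψ := by
    obtain ⟨i, hi, hφ⟩ := mem_relevantFormulas.1 hφ
    exact mem_relevantFormulas.2 ⟨i, hi, mem_subs_trans hφ hψ⟩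
  depth_le hφ := by
    obtain ⟨i, -, hφ⟩ := mem_relevantFormulas.1 hφ
    exact (depth_le_of_mem_subs hφ).trans (depth_prefixFormula_le hd i)
  card_le_two_pow := hL

end Sizes

/-! ### Choice of the parameters -/

section Parameters

variable {p : ℕ} {V : Type u} {H : ℕ}

theorem sq_mul_pow_le (hpH : p ≤ H) (d : ℕ) : (H ^ 2 * p) ^ (d + 1) ≤ H ^ (3 * d + 3) :=
  calc
    (H ^ 2 * p) ^ (d + 1) ≤ (H ^ 2 * H) ^ (d + 1) := by gcongr
    _ = H ^ (3 * d + 3) := by ring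

theorem budget_sq [Fintype V] {d e : ℕ} (hH : 2 ≤ H) (hpH : p ≤ H)
    (hV : Fintype.card V + 1 ≤ 2 ^ H) (he : H ^ (3 * d + 4) ≤ e) : Budget p V (H ^ 2) H d e where
  card_le := hV
  one_le := Nat.one_le_pow _ _ (by omega)
  degree_le :=
    calc
      2 * (H ^ 2 * p) ^ (d + 1) ≤ H * H ^ (3 * d + 3) := Nat.mul_le_mul hH (sq_mul_pow_le hpH d)
      _ = H ^ (3 * d + 4) := (pow_succ' _ _).symm
      _ ≤ e := he

theorem unitCost_sq_le (hH : 100 ≤ H) (hpH : p ≤ H) (d : ℕ) :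
    unitCost p (H ^ 2) H (2 * H + 3) d ≤ H ^ (3 * d + 8) := by
  have hpos : 0 < H ^ (3 * d + 3) := pow_pos (by omega) _
  have hle : H ≤ H * H ^ (3 * d + 3) := Nat.le_mul_of_pos_right _ hpos
  have hlarge : H ≤ H ^ 4 * H ^ (3 * d + 3) := hle.trans <|
    Nat.mul_le_mul_right _ (Nat.le_self_pow (by omega) H)
  have hmul : mulCost p H ((H ^ 2 * p) ^ (d + 1)) ≤ 16 * (H * H ^ (3 * d + 3)) := by
    have := Nat.mul_le_mul_left H (sq_mul_pow_le hpH d)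
    rw [mulCost]
    omega
  calc
    unitCost p (H ^ 2) H (2 * H + 3) d
      ≤ 5 * (H ^ 2 * (H * (16 * (H * H ^ (3 * d + 3))))) + (2 * H + 3) := by
        rw [unitCost]
        gcongr
    _ = 80 * (H ^ 4 * H ^ (3 * d + 3)) + (2 * H + 3) := by ring
    _ ≤ 100 * (H ^ 4 * H ^ (3 * d + 3)) := by omega
    _ ≤ H * (H ^ 4 * H ^ (3 * d + 3)) := Nat.mul_le_mul_right _ hH
    _ = H ^ (3 * d + 8) := by ring

theorem card_relevantFormulas_le_two_pow {π : List (Sequent p V)} (hsize : proofSize π ≤ 2 ^ H) :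
    (relevantFormulas π).card ≤ 2 ^ (2 * H + 3) := by
  have hpos := Nat.one_le_two_pow (n := H)
  have hlen := length_le_proofSize π
  calc
    (relevantFormulas π).card ≤ (π.length + 1) * (2 * proofSize π + 1) :=
      card_relevantFormulas_le π
    _ ≤ (2 * 2 ^ H) * (4 * 2 ^ H) := Nat.mul_le_mul (by omega) (by omega)
    _ = 2 ^ (2 * H + 3) := by ring

theorem exists_searchTree_of_isRefutation [Fact p.Prime] [Fintype V]
    {F : Finset (MvPolynomial V (ZMod p))} {d D e : ℕ} (hH : 100 ≤ H) (hpH : p ≤ H) (hDH : D ≤ H)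
    (hV : Fintype.card V + 1 ≤ 2 ^ H) (he : H ^ (3 * d + 22) ≤ e)
    (hF : ∀ f ∈ F, f.totalDegree ≤ D) {π : List (Sequent p V)}
    (hπ : IsRefutation d (eqFormula '' (F : Set (MvPolynomial V (ZMod p)))) π)
    (hsize : proofSize π ≤ 2 ^ H) (Ω : Finset (LowDeg p V e → ZMod p)) :
    ∃ T : SearchTree p (LowDeg p V e) (ErrorLabel p F e),
      T.DepthLE e ∧ probNoError Ω T ≤ 1 / 2 := by
  classical
  have hp := (Fact.out : p.Prime).two_le
  have hcard := card_relevantFormulas_le_two_pow hsize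
  have hb : Budget p V (H ^ 2) H (d + 4) e :=
    budget_sq (by omega) hpH hV ((Nat.pow_le_pow_right (by omega) (by omega)).trans he)
  have hR := admissible_relevantFormulas hb hπ.depth_le hcard
  have hcoeff : 2 * (relevantFormulas π).card ^ 2 ≤ p ^ H ^ 2 :=
    calc
      2 * (relevantFormulas π).card ^ 2 ≤ 2 * (2 ^ (2 * H + 3)) ^ 2 := by gcongr
      _ = 2 ^ (4 * H + 7) := by ring
      _ ≤ 2 ^ H ^ 2 := Nat.pow_le_pow_right two_pos (by nlinarith)
      _ ≤ p ^ H ^ 2 := Nat.pow_le_pow_left hp _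
  obtain ⟨ρ, hρ⟩ := exists_card_not_good_le
    (fun φs hφs a ha => hR.mem_of_mem_subs hφs (Formula.mem_subs_of_mem_disjuncts ha)) hcoeff Ω
  have hD : D ≤ (H ^ 2 * p) ^ (d + 4 + 1) := hDH.trans <| by
    refine (Nat.le_self_pow (n := 2) (by omega) H).trans ?_
    exact (Nat.le_mul_of_pos_right _ (by omega)).trans (Nat.le_self_pow (by omega) _)
  have hlen : π.length ≤ 2 ^ (2 * H + 3) :=
    (length_le_proofSize π).trans (hsize.trans (Nat.pow_le_pow_right two_pos (by omega)))
  have hforced := hR.forced_not_good (F := F) (ρ := ρ) hπ hlen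
    (fun i hi => mem_relevantFormulas.2 ⟨i, hi, Formula.mem_subs_self _⟩) (by
      rintro _ ⟨f, hf, rfl⟩ hfR
      exact hR.forced_eqFormula hf hfR (hF f hf) hD)
  refine exists_probNoError_le_half (hforced.le ?_) hρ
  calc
    _ = (10 * D + 212) * unitCost p (H ^ 2) H (2 * H + 3) (d + 4) := by ring
    _ ≤ (H * H) * H ^ (3 * (d + 4) + 8) :=
      Nat.mul_le_mul (by nlinarith) (unitCost_sq_le hH hpH _)
    _ = H ^ (3 * d + 22) := by ring
    _ ≤ e := he

end Parameters

section Asymptotics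

theorem eventually_mul_le_rpow {ι : Type*} {l : Filter ι} {f g r : ι → ℝ} (hf : Tendsto f l atTop)
    (hg : Tendsto g l atTop) (hr : ∀ᶠ i in l, f i ^ g i ≤ r i) {c : ℝ} (hc : 0 < c) (A : ℝ) :
    ∀ᶠ i in l, A * f i ≤ r i ^ c := by
  filter_upwards [hr, hg.eventually_ge_atTop (2 / c), hf.eventually_ge_atTop 1,
    hf.eventually_ge_atTop A] with i hri hgi hfi hA
  calc
    A * f i ≤ f i ^ 2 := by rw [sq]; gcongr
    _ = (f i ^ (2 / c)) ^ c := by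
      rw [← Real.rpow_mul (by positivity), div_mul_cancel₀ _ hc.ne', Real.rpow_two]
    _ ≤ (f i ^ g i) ^ c := by gcongr
    _ ≤ r i ^ c := by gcongr

theorem eventually_mul_pow_add_one_le_two_pow_floor {z : ℕ → ℝ}
    (hz : ∀ A, ∀ᶠ n : ℕ in atTop, A * Real.log n ≤ z n) (C : ℕ) :
    ∀ᶠ n : ℕ in atTop, C * n ^ C + 1 ≤ 2 ^ ⌊z n⌋₊ := by
  have hlog : Tendsto (fun n : ℕ => Real.log n) atTop atTop :=
    Real.tendsto_log_atTop.comp tendsto_natCast_atTop_atTop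
  filter_upwards [hz (2 * (C + 1) + 1), hlog.eventually_ge_atTop 1, eventually_ge_atTop (C + 1)]
    with n hzn hlogn hn
  have hn_pos : 0 < n := (Nat.succ_pos C).trans_le hn
  have hfloor : (C + 1) * Real.log n ≤ ⌊z n⌋₊ * Real.log 2 := by
    have := Nat.sub_one_lt_floor (z n)
    have := Real.log_two_gt_d9
    nlinarith
  calc
    C * n ^ C + 1 ≤ (C + 1) * n ^ C := by
      rw [add_mul, one_mul]
      exact Nat.add_le_add_left (Nat.one_le_pow _ _ hn_pos) _
    _ ≤ n ^ (C + 1) := by rw [pow_succ']; exact Nat.mul_le_mul_right _ hn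
    _ ≤ 2 ^ ⌊z n⌋₊ := by
      have hpow : (n : ℝ) ^ (C + 1) ≤ 2 ^ ⌊z n⌋₊ := by
        rw [← Real.log_le_log_iff (by positivity) (by positivity), Real.log_pow, Real.log_pow]
        exact_mod_cast hfloor
      exact_mod_cast hpow

theorem floor_rpow_inv_pow_le (r : ℕ) {k : ℕ} (hk : k ≠ 0) :
    ⌊(r : ℝ) ^ (k : ℝ)⁻¹⌋₊ ^ k ≤ r := by
  have hpow : (⌊(r : ℝ) ^ (k : ℝ)⁻¹⌋₊ : ℝ) ^ k ≤ ((r : ℝ) ^ (k : ℝ)⁻¹) ^ k := by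
    gcongr
    exact Nat.floor_le (by positivity)
  rw [Real.rpow_inv_natCast_pow r.cast_nonneg hk] at hpow
  exact_mod_cast hpow

theorem le_two_pow_floor_rpow {r s : ℕ} {c ε : ℝ} (hr : 1 ≤ r) (hc : 0 ≤ c) (hε : ε ≤ c)
    (hs : (s : ℝ) ≤ 2 ^ (1 / 2 * (r : ℝ) ^ ε)) : s ≤ 2 ^ ⌊(r : ℝ) ^ c⌋₊ := by
  have hr : (1 : ℝ) ≤ r := by exact_mod_cast hr
  have hrε : (r : ℝ) ^ ε ≤ r ^ c := Real.rpow_le_rpow_of_exponent_le hr hε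
  have hfloor := Nat.div_two_lt_floor (Real.one_le_rpow hr hc)
  have hle : (s : ℝ) ≤ 2 ^ (⌊(r : ℝ) ^ c⌋₊ : ℝ) :=
    hs.trans (Real.rpow_le_rpow_of_exponent_le one_le_two (by linarith))
  rw [Real.rpow_natCast] at hle
  exact_mod_cast hle

theorem eventually_le_floor_rpow {r : ℕ → ℕ} {g : ℕ → ℝ} (hg : Tendsto g atTop atTop)
    (hr : ∀ᶠ n : ℕ in atTop, Real.log (n : ℝ) ^ g n ≤ (r n : ℝ)) {c : ℝ} (hc : 0 < c) (m C : ℕ) :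
    ∀ᶠ n : ℕ in atTop, m ≤ ⌊(r n : ℝ) ^ c⌋₊ ∧ C * n ^ C + 1 ≤ 2 ^ ⌊(r n : ℝ) ^ c⌋₊ := by
  have hlog : Tendsto (fun n : ℕ => Real.log n) atTop atTop :=
    Real.tendsto_log_atTop.comp tendsto_natCast_atTop_atTop
  have hz := eventually_mul_le_rpow hlog hg hr hc
  filter_upwards [hz 1, hlog.eventually_ge_atTop (m : ℝ),
    eventually_mul_pow_add_one_le_two_pow_floor hz C] with n hlogz hm hC
  exact ⟨Nat.le_floor (hm.trans ((one_mul _).symm.trans_le hlogz)), hC⟩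

end Asymptotics

end ModFrege

open ModFrege in
theorem theorem6p2_general (p : ℕ) [Fact p.Prime] (r : ℕ → ℕ)
    (hr : ∃ g : ℕ → ℝ, Tendsto g atTop atTop ∧
      ∀ᶠ n : ℕ in atTop, Real.log (n : ℝ) ^ g n ≤ (r n : ℝ))
    (V : ℕ → Type*) [∀ n, Fintype (V n)] (F : ∀ n, Finset (MvPolynomial (V n) (ZMod p)))
    (hdeg : ∃ D : ℕ, ∀ n ≥ 1, ∀ f ∈ F n, f.totalDegree ≤ D)
    (hcard : ∃ C : ℕ, ∀ n ≥ 1, Fintype.card (V n) ≤ C * n ^ C) (d : ℕ) :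
    ∃ ε_d : ℝ, 0 < ε_d ∧ ∃ n_d : ℕ, 1 ≤ n_d ∧ ∃ δ : ℝ, 0 < δ ∧ ∀ n : ℕ, n_d ≤ n →
      ∀ Ω : Finset (LowDeg p (V n) (r n) → ZMod p), Ω.Nonempty → ∀ ε : ℝ, 0 < ε → ε ≤ ε_d →
      (∀ T : SearchTree p (LowDeg p (V n) (r n)) (ErrorLabel p (F n) (r n)), T.DepthLE (r n) →
        1 - (2 : ℝ) ^ (-((r n : ℝ) ^ ε)) < probNoError Ω T) →
      ∀ π : List (Sequent p (V n)),
        IsRefutation d (eqFormula '' (F n : Set (MvPolynomial (V n) (ZMod p)))) π →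
        (2 : ℝ) ^ (δ * (r n : ℝ) ^ ε) ≤ (proofSize π : ℝ) := by
  obtain ⟨g, hg, hr⟩ := hr
  obtain ⟨D, hD⟩ := hdeg
  obtain ⟨C, hC⟩ := hcard
  set c : ℝ := ((3 * d + 22 : ℕ) : ℝ)⁻¹ with hc
  have hc_pos : 0 < c := by positivity
  obtain ⟨N, hN⟩ := eventually_atTop.1 (eventually_le_floor_rpow hg hr hc_pos (100 + p + D) C)
  refine ⟨c, hc_pos, max N 1, le_max_right _ _, 1 / 2, by norm_num, ?_⟩
  intro n hn Ω _ ε hε hεc hT π hπ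
  obtain ⟨hNn, hn⟩ := max_le_iff.1 hn
  obtain ⟨hH, hCn⟩ := hN n hNn
  have hHr := floor_rpow_inv_pow_le (r n) (k := 3 * d + 22) (by omega)
  rw [← hc] at hHr
  have hr_one : 1 ≤ r n := (Nat.one_le_pow _ _ (by omega)).trans hHr
  by_contra! hsmall
  have hsize := le_two_pow_floor_rpow hr_one hc_pos.le hεc hsmall.le
  obtain ⟨T, hdepth, hhalf⟩ := exists_searchTree_of_isRefutation (by omega) (by omega) (by omega)
    ((Nat.add_le_add_right (hC n hn) 1).trans hCn) hHr (hD n hn) hπ hsize Ω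
  have hr_rpow : 1 ≤ (r n : ℝ) ^ ε := Real.one_le_rpow (by exact_mod_cast hr_one) hε.le
  have hfail : (2 : ℝ) ^ (-((r n : ℝ) ^ ε)) ≤ 2⁻¹ := by
    rw [← Real.rpow_neg_one]
    exact Real.rpow_le_rpow_of_exponent_le one_le_two (neg_le_neg hr_rpow)
  linarith [hT T hdepth]

theorem theorem6p2 (p : ℕ) [Fact p.Prime]
    -- `r(n) ≥ (log n)^{ω(1)}`
    (r : ℕ → ℕ)
    (hr : ∃ g : ℕ → ℝ, Tendsto g atTop atTop ∧
      ∀ᶠ n : ℕ in atTop, Real.log (n : ℝ) ^ g n ≤ (r n : ℝ))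
    -- the polynomial systems `F n` in the variables `V n`, for `n ≥ 1`
    (V : ℕ → Type*) [∀ n, Fintype (V n)]
    (F : ∀ n, Finset (MvPolynomial (V n) (ZMod p)))
    (hdeg : ∃ D : ℕ, ∀ n ≥ 1, ∀ f ∈ F n, f.totalDegree ≤ D)
    (hsize : ∃ C : ℕ, ∀ n ≥ 1, (F n).card ≤ C * n ^ C ∧ Fintype.card (V n) ≤ C * n ^ C)
    (hbool : ∀ n ≥ 1, ∀ x : V n, MvPolynomial.X x ^ 2 - MvPolynomial.X x ∈ F n)
    (hunsolv : ∀ n ≥ 1, ¬ ∃ a : V n → ZMod p, ∀ f ∈ F n, MvPolynomial.eval a f = 0) :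
    ∀ d : ℕ, 2 ≤ d → ∃ ε_d : ℝ, 0 < ε_d ∧ ∃ n_d : ℕ, 1 ≤ n_d ∧ ∃ δ : ℝ, 0 < δ ∧
      ∀ n : ℕ, n_d ≤ n →
      ∀ Ω : Finset (ModFrege.LowDeg p (V n) (r n) → ZMod p), Ω.Nonempty →
      ∀ ε : ℝ, 0 < ε → ε ≤ ε_d →
      (∀ T : ModFrege.SearchTree p (ModFrege.LowDeg p (V n) (r n))
            (ModFrege.ErrorLabel p (F n) (r n)),
          T.DepthLE (r n) →
          1 - (2 : ℝ) ^ (-((r n : ℝ) ^ ε)) < ModFrege.probNoError Ω T) →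
      ∀ π : List (ModFrege.Sequent p (V n)),
        ModFrege.IsRefutation d (ModFrege.eqFormula '' (F n : Set (MvPolynomial (V n) (ZMod p)))) π →
        (2 : ℝ) ^ (δ * (r n : ℝ) ^ ε) ≤ (ModFrege.proofSize π : ℝ) :=
  fun d _ => theorem6p2_general p r hr V F hdeg (hsize.imp fun _ hC n hn => (hC n hn).2) d
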